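/- **Theorem 18.** Conventions. A family $\mathcal R$ of finite subsets of $\mathbb N=\{1,2,\dots\}$ is *regular* if it is compact (in $\{0,1\}^{\mathbb N}$, via characteristic functions), hereditary (closed under subsets) and spreading (if $\{n_1<\dots<n_m\}\in\mathcal R$ and $n_i\le n_i'$ for all $i$, where $n_1'<\dots<n_m'$, then $\{n_1',\dots,n_m'\}\in\mathcal R$). Its order is the rank of $\emptyset$, where $\operatorname{rank}(s)=\sup\{\operatorname{rank}(t)+1: t\in\mathcal R,\ s\subsetneq t\}$. A *regular thin family* $\mathcal F$ of order $\xi$ is the set of maximal elements (under inclusion) of a regular family of order $\xi$; $\widehat{\mathcal F}$ is the set of all subsets of elements of $\mathcal F$, and $\mathcal F\restriction L=\{s\in\mathcal F: s\subseteq L\}$, $\widehat{\mathcal F}\restriction L=\{s\in\widehat{\mathcal F}: s\subseteq L\}$ for infinite $L\subseteq\mathbb N$. Write $s(i)$, $L(i)$ for the $i$-th element. Nonempty finite sets $s_1,\dots,s_k$ form a *plegma family* if $s_i(m)<s_j(m)$ whenever $i<j$ and $m\le\min(|s_i|,|s_j|)$, and $s_i(m)<s_j(m+1)$ for all $i,j$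 whenever $m\le\min(|s_i|,|s_j|-1)$. Let $X$ be a real Banach space. A family $(x_s)_{s\in\mathcal F\restriction L}$ in $X$ is *subordinated* if there is a map $\widehat\varphi:\widehat{\mathcal F}\restriction L\to X$, continuous from the topology of $\{0,1\}^{\mathbb N}$ to the weak topology of $X$, with $\widehat\varphi(s)=x_s$ for $s\in\mathcal F\restriction L$. It is *weakly null* if for all $x^*\in X^*$ and $\varepsilon>0$ there is $n_0$ with $|x^*(x_s)|<\varepsilon$ whenever $s\in\mathcal F\restriction L$ and $\min s\ge n_0$. It *generates* $(e_n)_n$, a Hamel basis of a seminormed space $(E,\|\cdot\|_*)$, *as a spreading model* if there is a null sequence $(\delta_n)_n$ of positive reals such that for all $1\le k\le l$, $a_1,\dots,a_k\in[-1,1]$ and all plegma families $(s_j)_{j=1}^k$ in $\mathcal F\restriction L$ with $s_1(1)\ge L(l)$, $$\Big|\,\Big\|\sum_{j=1}^k a_jx_{s_j}\Big\|-\Big\|\sum_{j=1}^k a_je_j\Big\|_*\Big|\le\delta_l .$$ For a countable ordinal $\xi\ge1$ let $SM_\xi^w(X)$ be the set of all sequences $(e_n)_n$ generated as spreading models by subordinated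 weakly null families $(x_s)_{s\in\mathcal F\restriction L}$ in $X$, where $\mathcal F$ is a regular thin family of order $\xi$ and $L\subseteq\mathbb N$ is infinite; two sequences that induce the same seminorm on the finitely supported real sequences are identified. Write $(e_n)_n\preceq(f_n)_n$ if there is $C>0$ with $\|\sum_{i=1}^n a_ie_i\|\le C\|\sum_{i=1}^n a_if_i\|$ for all $n$ and all $a_1,\dots,a_n\in\mathbb R$, and $(e_n)_n\sim(f_n)_n$ if $(e_n)_n\preceq(f_n)_n\preceq(e_n)_n$. Statement. Let $X$ be a real Banach space and $\xi\ge1$ a countable ordinal. Then the quotient $SM_\xi^w(X)/{\sim}$, with the partial order induced by $\preceq$, is an upper semi-lattice: any two of its elements have a least upper bound. Moreover, for every $k\ge1$ and all $(e_n^1)_n,\dots,(e_n^k)_n\in SM_\xi^w(X)$ there is $(e_n)_n\in SM_\xi^w(X)$ such that for all $l\in\mathbb N$ and $a_1,\dots,a_l\in\mathbb R$ $$\max_{1\le i\le k}\Big\|\sum_{j=1}^l a_je_j^i\Big\|\le\Big\|\sum_{j=1}^l a_je_j\Big\|\le\sum_{i=1}^k\Big\|\sum_{j=1}^l a_je_j^i\Big\|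 .$$ -/

import Mathlib

open scoped Ordinal Topology

/-! Finite and infinite subsets of the natural numbers are indexed from `0`: `Nat.nth (· ∈ s) i`
is the `i`-th element of `s` in increasing order, `i = 0` being its minimum. The index set is
`ℕ = {0, 1, 2, …}`; all the notions below depend only on its order. -/

/-- The `i`-th element of a finite set of natural numbers (meaningful for `i < s.card`). -/
noncomputable def finElt (s : Finset ℕ) (i : ℕ) : ℕ := Nat.nth (· ∈ s) i

/-- The `i`-th element of an infinite set of natural numbers. -/
noncomputable def infElt (M : Set ℕ) (i : ℕ) : ℕ := Nat.nth (· ∈ M) i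

/-- The characteristic function of a finite set, as a point of the Cantor space. -/
def charFun (s : Finset ℕ) : ℕ → Bool := fun n => decide (n ∈ s)

/-- A family of finite sets is regular if it is compact, hereditary and spreading. -/
structure IsRegularFamily (R : Set (Finset ℕ)) : Prop where
  compact : IsCompact (charFun '' R)
  hereditary : ∀ s ∈ R, ∀ t, t ⊆ s → t ∈ R
  spreading : ∀ s ∈ R, ∀ t : Finset ℕ, t.card = s.card →
    (∀ i < s.card, finElt s i ≤ finElt t i) → t ∈ R

/-- `R` has order `ξ`: the rank of `∅` for reverse inclusion on `R` is `ξ`, where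
`rank s = sup {rank t + 1 : t ∈ R, s ⊂ t}` (so that maximal elements have rank `0`). -/
def HasOrder (R : Set (Finset ℕ)) (ξ : Ordinal.{0}) : Prop :=
  ∃ h : Acc (fun t s : Finset ℕ => t ∈ R ∧ s ⊂ t) ∅, h.rank = ξ

/-- `F` is a regular thin family of order `ξ`: it consists of the maximal elements, under
inclusion, of a regular family of order `ξ`. -/
def IsRegularThinOfOrder (F : Set (Finset ℕ)) (ξ : Ordinal.{0}) : Prop :=
  ∃ R : Set (Finset ℕ), IsRegularFamily R ∧ HasOrder R ξ ∧ F = {s | Maximal (· ∈ R) s}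

/-- The restriction of a family of finite sets to the subsets of `L`. -/
def restrictFamily (F : Set (Finset ℕ)) (L : Set ℕ) : Set (Finset ℕ) :=
  {s | s ∈ F ∧ (s : Set ℕ) ⊆ L}

/-- The closure of a regular thin family: all subsets of its elements. -/
def familyHat (F : Set (Finset ℕ)) : Set (Finset ℕ) :=
  {s | ∃ t ∈ F, s ⊆ t}

/-- Plegma families of finite sets. -/
structure IsPlegma {k : ℕ} (s : Fin k → Finset ℕ) : Prop where
  nonempty : ∀ i, (s i).Nonempty
  lt_of_lt : ∀ i j : Fin k, i < j → ∀ m : ℕ, m < (s i).card → m < (s j).card →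
    finElt (s i) m < finElt (s j) m
  lt_succ : ∀ i j : Fin k, ∀ m : ℕ, m < (s i).card → m + 1 < (s j).card →
    finElt (s i) m < finElt (s j) (m + 1)

section Banach

variable {X : Type*} [NormedAddCommGroup X] [NormedSpace ℝ X]

/-- The subsequence `(x_s)`, `s ∈ F ↾ M`, generates the spreading model `(e_n)`.

A sequence `(e_n)` which is a Hamel basis of a seminormed space is given by a seminorm `p` on the
space of finitely supported real sequences, `e_n` being the `n`-th unit vector. The values of `x`
outside `F ↾ M` play no role. The number `l + 1` is the `l` of the one-based indexing. -/
def GeneratesSpreadingModel (F : Set (Finset ℕ)) (x : Finset ℕ → X) (M : Set ℕ)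
    (p : Seminorm ℝ (ℕ →₀ ℝ)) : Prop :=
  ∃ δ : ℕ → ℝ, (∀ l, 0 < δ l) ∧ Filter.Tendsto δ Filter.atTop (𝓝 0) ∧
    ∀ (l k : ℕ) (hk : 0 < k), k ≤ l + 1 →
      ∀ a : Fin k → ℝ, (∀ j, a j ∈ Set.Icc (-1 : ℝ) 1) →
        ∀ s : Fin k → Finset ℕ, (∀ j, s j ∈ restrictFamily F M) → IsPlegma s →
          infElt M l ≤ finElt (s ⟨0, hk⟩) 0 →
            |‖∑ j, a j • x (s j)‖ - p (∑ j : Fin k, Finsupp.single (j : ℕ) (a j))| ≤ δ l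

/-- The subsequence `(x_s)`, `s ∈ F ↾ L`, is weakly null. -/
def IsWeaklyNull (F : Set (Finset ℕ)) (x : Finset ℕ → X) (L : Set ℕ) : Prop :=
  ∀ f : X →L[ℝ] ℝ, ∀ ε : ℝ, 0 < ε → ∃ n₀ : ℕ,
    ∀ s ∈ restrictFamily F L, (∀ n ∈ s, n₀ ≤ n) → |f (x s)| < ε

/-- The subsequence `(x_s)`, `s ∈ F ↾ L`, is subordinated: it extends to a map on the closure
`familyHat F ↾ L` (a subspace of the Cantor space) which is continuous for the weak topology. -/
def IsSubordinated (F : Set (Finset ℕ)) (x : Finset ℕ → X) (L : Set ℕ) : Prop :=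
  ∃ φ : (ℕ → Bool) → X,
    ContinuousOn (fun c => toWeakSpace ℝ X (φ c)) (charFun '' restrictFamily (familyHat F) L) ∧
      ∀ s ∈ restrictFamily F L, x s = φ (charFun s)

end Banach

/-- The set of the `ξ`-order spreading models generated by subordinated weakly null subsequences
`(x_s)`, `s ∈ F ↾ L`, in `X`, over all regular thin families `F` of order `ξ`. -/
def spreadingModelSet (X : Type*) [NormedAddCommGroup X] [NormedSpace ℝ X] (ξ : Ordinal.{0}) :
    Set (Seminorm ℝ (ℕ →₀ ℝ)) :=
  {p | ∃ (F : Set (Finset ℕ)) (L : Set ℕ) (x : Finset ℕ → X),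
    IsRegularThinOfOrder F ξ ∧ L.Infinite ∧ IsSubordinated F x L ∧ IsWeaklyNull F x L ∧
      GeneratesSpreadingModel F x L p}

/-- `spreadingModelSet X ξ` as a type, to carry the preorder of domination
(rather than the pointwise order of seminorms). -/
structure SM (X : Type*) [NormedAddCommGroup X] [NormedSpace ℝ X] (ξ : Ordinal.{0}) where
  /-- The seminorm on the finitely supported sequences. -/
  norm : Seminorm ℝ (ℕ →₀ ℝ)
  mem : norm ∈ spreadingModelSet X ξ

/-- Domination: `e ≤ f` if there is `C > 0` with `‖∑ aᵢ eᵢ‖ ≤ C ‖∑ aᵢ fᵢ‖` for all finitely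
supported real sequences `a`. -/
instance (X : Type*) [NormedAddCommGroup X] [NormedSpace ℝ X] (ξ : Ordinal.{0}) :
    Preorder (SM X ξ) where
  le e f := ∃ C : ℝ, 0 < C ∧ ∀ a : ℕ →₀ ℝ, e.norm a ≤ C * f.norm a
  le_refl e := ⟨1, one_pos, fun a => by simp⟩
  le_trans e f g := by
    rintro ⟨C, hC, h⟩ ⟨D, hD, h'⟩
    refine ⟨C * D, mul_pos hC hD, fun a => (h a).trans ?_⟩
    rw [mul_assoc]
    exact mul_le_mul_of_nonneg_left (h' a) hC.le

/-- The quotient of `SM X ξ` by the equivalence `e ≤ f ∧ f ≤ e`, with the induced partial order. -/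
abbrev SMQuotient (X : Type*) [NormedAddCommGroup X] [NormedSpace ℝ X] (ξ : Ordinal.{0}) :=
  Antisymmetrization (SM X ξ) (· ≤ ·)

/-! Two families x⁰, x¹, carried by regular families R₀, R₁ on sets L₀, L₁, are joined by adding
them over a common index. The union S = R₀ ∪ R₁ is again regular of order ξ (`HasOrder.union`). Take
a strictly increasing sequence m with even terms in L₀ and odd terms in L₁, and use as indices the
maximal elements s of S contained in the set of odd terms. Moving each m(2i+1) to m(2i+b) and
keeping the longest initial segment in R_b turns s into a maximal element Ψ_b(s) of R_b
(`shiftTrunc_mem_maximal`). The joined family is z_s = x⁰ at Ψ₀(s) plus x¹ at Ψ₁(s). Weak nullness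
is inherited, and z is subordinated because each Ψ_b is continuous on the Cantor space.

The sequence m must make the norms of combinations of z converge along plegma families. A plegma
tuple, read in increasing order, is filled in a forced order: the next coordinate is the unfinished
one with the fewest elements, ties going to the smallest index. Choosing every new integer along an
ultrafilter produces, by well-founded recursion, an ultrafilter `leaf` of completed tuples and a
limit `leafValue` of the norms. Almost every one-step extension changes this value very little, so a
diagonal choice of m (`exists_interlacing`) bounds the total change along a plegma tuple by a
geometric tail (`abs_norm_sub_leafValue_le`).

The limit is at most the sum of the two given seminorms by the triangle inequality. It is at least
each of them because closed convex sets are weakly closed: leaving the coordinates of the other kind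
unextended replaces vectors by their weak limits and does not increase the limit norm
(`LimLE.freeze`), and at ∅ these limits vanish (`vec_empty`). A spreading model between the maximum
and the sum of two others is their least upper bound up to equivalence, and iteration handles
finitely many. -/

open Filter

/-! ### Positions in finite sets -/

/-- The number of elements of `s` below `n`. -/
def pos (s : Finset ℕ) (n : ℕ) : ℕ := (s.filter (· < n)).card

theorem pos_eq_count (s : Finset ℕ) (n : ℕ) : pos s n = Nat.count (· ∈ s) n := by
  rw [Nat.count_eq_card_filter_range, pos]
  congr 1
  ext a
  simp [and_comm]

theorem finElt_pos {s : Finset ℕ} {n : ℕ} (h : n ∈ s) : finElt s (pos s n) = n := by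
  rw [pos_eq_count]
  exact Nat.nth_count (p := (· ∈ s)) h

theorem pos_lt_card {s : Finset ℕ} {n : ℕ} (h : n ∈ s) : pos s n < s.card :=
  Finset.card_lt_card (Finset.filter_ssubset.2 ⟨n, h, lt_irrefl n⟩)

theorem finElt_mem {s : Finset ℕ} {i : ℕ} (h : i < s.card) : finElt s i ∈ s :=
  Nat.nth_mem (p := (· ∈ s)) i fun hf => by
    convert h
    ext
    simp

theorem pos_finElt {s : Finset ℕ} {i : ℕ} (h : i < s.card) : pos s (finElt s i) = i := by
  rw [pos_eq_count]
  exact Nat.count_nth (p := (· ∈ s)) fun hf => by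
    convert h
    ext
    simp

theorem pos_mono (s : Finset ℕ) {a b : ℕ} (h : a ≤ b) : pos s a ≤ pos s b :=
  Finset.card_le_card fun x hx => by
    simp only [Finset.mem_filter] at hx ⊢
    exact ⟨hx.1, hx.2.trans_le h⟩

theorem pos_lt_pos {s : Finset ℕ} {a b : ℕ} (ha : a ∈ s) (h : a < b) : pos s a < pos s b :=
  Finset.card_lt_card <| Finset.ssubset_iff_of_subset (fun x hx => by
    simp only [Finset.mem_filter] at hx ⊢
    exact ⟨hx.1, hx.2.trans h⟩) |>.2 ⟨a, by simp [ha, h], by simp⟩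

theorem lt_of_pos_lt {s : Finset ℕ} {a b : ℕ} (h : pos s a < pos s b) : a < b :=
  lt_of_not_ge fun hba => (pos_mono s hba).not_gt h

theorem eq_of_pos_eq {s : Finset ℕ} {a b : ℕ} (ha : a ∈ s) (hb : b ∈ s)
    (h : pos s a = pos s b) : a = b := by
  rw [← finElt_pos ha, h, finElt_pos hb]

theorem finElt_zero_le {s : Finset ℕ} {a : ℕ} (ha : a ∈ s) : finElt s 0 ≤ a := by
  by_contra! h
  have := pos_lt_pos ha h
  rw [pos_finElt (Finset.card_pos.2 ⟨a, ha⟩)] at this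
  omega

theorem pos_of_forall_lt {s : Finset ℕ} {n : ℕ} (h : ∀ a ∈ s, a < n) : pos s n = s.card := by
  rw [pos, Finset.filter_true_of_mem h]

/-! ### Regular families -/

/-- The relation of proper extension inside a family. -/
def ProperExt (R : Set (Finset ℕ)) (t s : Finset ℕ) : Prop := t ∈ R ∧ s ⊂ t

/-- Spreading in counting form: for sets of equal size, lying further to the right means having at
most as many elements below each threshold. Counts behave better than indices under insertions and
images. -/
theorem IsRegularFamily.mem_of_pos_le {R : Set (Finset ℕ)} (hR : IsRegularFamily R)
    {s t : Finset ℕ} (hs : s ∈ R) (hcard : t.card = s.card) (h : ∀ x, pos t x ≤ pos s x) :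
    t ∈ R := by
  refine hR.spreading s hs t hcard fun i hi => ?_
  by_contra! hlt
  have hi' : i < t.card := hcard ▸ hi
  have h1 := pos_lt_pos (finElt_mem hi') hlt
  have h2 := h (finElt s i)
  rw [pos_finElt hi'] at h1
  rw [pos_finElt hi] at h2
  omega

theorem IsRegularFamily.mem_of_image {R : Set (Finset ℕ)} (hR : IsRegularFamily R)
    {s : Finset ℕ} {σ : ℕ → ℕ} (hσ : ∀ n ∈ s, σ n ≤ n) (hinj : Set.InjOn σ s)
    (hs : s.image σ ∈ R) : s ∈ R := by
  refine hR.mem_of_pos_le hs (Finset.card_image_of_injOn hinj).symm fun x => ?_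
  refine Finset.card_le_card_of_injOn σ (fun a ha => ?_) (fun a ha b hb => ?_)
  · simp only [Finset.coe_filter, Set.mem_ofPred_eq, Finset.mem_image] at ha ⊢
    exact ⟨⟨a, ha.1, rfl⟩, (hσ a ha.1).trans_lt ha.2⟩
  · simp only [Finset.coe_filter, Set.mem_ofPred_eq] at ha hb
    exact hinj ha.1 hb.1

/-- Heredity yields some one-point extension, and spreading pushes its new point to any place beyond
all the others. -/
theorem IsRegularFamily.eventually_insert_mem {R : Set (Finset ℕ)} (hR : IsRegularFamily R)
    {s : Finset ℕ} (hs : s ∈ R) (hmax : ¬ Maximal (· ∈ R) s) :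
    ∀ᶠ n in atTop, insert n s ∈ R := by
  obtain ⟨t, ht, hst⟩ : ∃ t ∈ R, s ⊂ t := by
    by_contra! h
    refine hmax ⟨hs, fun t ht hst => ?_⟩
    by_contra hts
    exact h t ht ⟨hst, hts⟩
  obtain ⟨a, hat, has⟩ := Finset.exists_of_ssubset hst
  have hR' : insert a s ∈ R := hR.hereditary t ht _ (Finset.insert_subset hat hst.1)
  filter_upwards [eventually_gt_atTop ((insert a s).sup id)] with n hn
  have hlt : ∀ b ∈ insert a s, b < n := fun b hb => (Finset.le_sup (f := id) hb).trans_lt hn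
  have hns : n ∉ s := fun h => (hlt n (Finset.mem_insert_of_mem h)).false
  have hc : (insert n s).card = (insert a s).card := by
    rw [Finset.card_insert_of_notMem hns, Finset.card_insert_of_notMem has]
  refine hR.mem_of_pos_le hR' hc fun x => ?_
  rcases le_or_gt x n with hx | hx
  · refine Finset.card_le_card fun b hb => ?_
    simp only [Finset.mem_filter, Finset.mem_insert] at hb ⊢
    rcases hb with ⟨rfl | hb, hbx⟩
    · omega
    · exact ⟨Or.inr hb, hbx⟩
  · rw [pos_of_forall_lt fun b hb => (hlt b hb).trans hx, ← hc]
    exact Finset.card_filter_le _ _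

theorem wellFounded_properExt {R : Set (Finset ℕ)} (h : Acc (ProperExt R) ∅) :
    WellFounded (ProperExt R) := by
  refine ⟨fun s => ⟨s, fun t ht => h.inv ⟨ht.1, ?_⟩⟩⟩
  exact (Finset.empty_subset s).trans_ssubset ht.2

theorem exists_maximal_superset {R : Set (Finset ℕ)} (h : WellFounded (ProperExt R))
    {s : Finset ℕ} (hs : s ∈ R) : ∃ t, Maximal (· ∈ R) t ∧ s ⊆ t := by
  induction s using h.induction with
  | _ s ih =>
    by_cases hm : Maximal (· ∈ R) s
    · exact ⟨s, hm, subset_rfl⟩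
    · obtain ⟨t, ht, hst⟩ : ∃ t ∈ R, s ⊂ t := by
        by_contra! h
        refine hm ⟨hs, fun t ht hst => ?_⟩
        by_contra hts
        exact h t ht ⟨hst, hts⟩
      obtain ⟨u, hu, htu⟩ := ih t ⟨ht, hst⟩ ht
      exact ⟨u, hu, hst.1.trans htu⟩

theorem familyHat_maximal {R : Set (Finset ℕ)} (hR : IsRegularFamily R)
    (h : WellFounded (ProperExt R)) : familyHat {s | Maximal (· ∈ R) s} = R := by
  ext s
  refine ⟨fun ⟨t, ht, hst⟩ => hR.hereditary t ht.1 s hst, fun hs => ?_⟩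
  obtain ⟨t, ht, hst⟩ := exists_maximal_superset h hs
  exact ⟨t, ht, hst⟩

theorem IsRegularFamily.union {R S : Set (Finset ℕ)} (hR : IsRegularFamily R)
    (hS : IsRegularFamily S) : IsRegularFamily (R ∪ S) where
  compact := by
    rw [Set.image_union]
    exact hR.compact.union hS.compact
  hereditary s hs t hts := hs.imp (fun h => hR.hereditary s h t hts)
    (fun h => hS.hereditary s h t hts)
  spreading s hs t hc h := hs.imp (fun hs => hR.spreading s hs t hc h)
    (fun hs => hS.spreading s hs t hc h)

theorem rank_le_of_strictMono {α : Type} {r : α → α → Prop} (f : α → Ordinal.{0})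
    (hf : ∀ a b, r b a → f b < f a) {a : α} (h : Acc r a) : h.rank ≤ f a := by
  induction h with
  | intro a h ih =>
    rw [Acc.rank_eq]
    exact Ordinal.iSup_le fun b => Order.succ_le_of_lt ((ih b b.2).trans_lt (hf a b b.2))

theorem rank_mono {α : Type} {r r' : α → α → Prop} (hr : ∀ a b, r b a → r' b a) {a : α}
    (h : Acc r a) (h' : Acc r' a) : h.rank ≤ h'.rank := by
  induction h with
  | intro a h ih =>
    rw [Acc.rank_eq]
    exact Ordinal.iSup_le fun b => Order.succ_le_of_lt
      ((ih b b.2 (h'.inv (hr a b b.2))).trans_lt (Acc.rank_lt_of_rel h' (hr a b b.2)))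

/-- The maximum of the two ranks strictly drops along proper extensions in the union: if the larger
set misses one family, its rank there is zero by heredity. At ∅ this maximum is ξ. -/
theorem HasOrder.union {R S : Set (Finset ℕ)} {ξ : Ordinal.{0}} (hR : IsRegularFamily R)
    (hS : IsRegularFamily S) (oR : HasOrder R ξ) (oS : HasOrder S ξ) : HasOrder (R ∪ S) ξ := by
  obtain ⟨aR, rfl⟩ := oR
  obtain ⟨aS, hξ⟩ := oS
  have wR := wellFounded_properExt aR
  have wS := wellFounded_properExt aS
  set f : Finset ℕ → Ordinal.{0} := fun s => max (wR.apply s).rank (wS.apply s).rank with hf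
  have rank_zero : ∀ {Q : Set (Finset ℕ)} (hQ : IsRegularFamily Q) (w : WellFounded (ProperExt Q))
      (t : Finset ℕ), t ∉ Q → (w.apply t).rank = 0 := by
    intro Q hQ w t ht
    rw [Acc.rank_eq]
    have : IsEmpty { b // ProperExt Q b t } :=
      ⟨fun b => ht (hQ.hereditary _ b.2.1 _ b.2.2.1)⟩
    simp
  have key : ∀ {Q Q' : Set (Finset ℕ)} (_ : IsRegularFamily Q') (w : WellFounded (ProperExt Q))
      (w' : WellFounded (ProperExt Q')) (s t : Finset ℕ), ProperExt Q t s →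
      max (w.apply t).rank (w'.apply t).rank < max (w.apply s).rank (w'.apply s).rank := by
    intro Q Q' hQ' w w' s t ht
    have h1 : (w.apply t).rank < (w.apply s).rank := Acc.rank_lt_of_rel (w.apply s) ht
    refine max_lt (lt_max_of_lt_left h1) ?_
    by_cases htQ : t ∈ Q'
    · have h2 : (w'.apply t).rank < (w'.apply s).rank :=
        Acc.rank_lt_of_rel (w'.apply s) (⟨htQ, ht.2⟩ : ProperExt Q' t s)
      exact lt_max_of_lt_right h2
    · rw [rank_zero hQ' w' t htQ]
      exact lt_max_of_lt_left ((zero_le).trans_lt h1)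
  have hlt : ∀ s t, ProperExt (R ∪ S) t s → f t < f s := by
    rintro s t ⟨ht | ht, hst⟩
    · exact key hS wR wS s t ⟨ht, hst⟩
    · have := key hR wS wR s t ⟨ht, hst⟩
      simpa only [hf, max_comm] using this
  have wU : WellFounded (ProperExt (R ∪ S)) :=
    Subrelation.wf (fun {t s} h => hlt s t h) (InvImage.wf f Ordinal.lt_wf)
  have hfe : f ∅ = aR.rank := by
    have : (wS.apply ∅).rank = (wR.apply ∅).rank := hξ
    exact max_eq_left this.le
  refine ⟨wU.apply ∅, le_antisymm ?_ ?_⟩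
  · exact (rank_le_of_strictMono f hlt (wU.apply ∅)).trans_eq hfe
  · exact rank_mono (fun a b h => ⟨Or.inl h.1, h.2⟩) aR (wU.apply ∅)

theorem HasOrder.exists_nonempty {R : Set (Finset ℕ)} {ξ : Ordinal.{0}} (h : HasOrder R ξ)
    (hξ : 1 ≤ ξ) : ∃ s ∈ R, s.Nonempty := by
  obtain ⟨a, rfl⟩ := h
  by_contra! hne
  rw [Acc.rank_eq] at hξ
  have : IsEmpty { b // b ∈ R ∧ ∅ ⊂ b } :=
    ⟨fun b => (Finset.empty_ssubset.1 b.2.2).ne_empty (by simpa using hne _ b.2.1)⟩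
  simp at hξ

/-! ### The growth process of a tuple of finite sets -/

section Growth

set_option linter.unusedSectionVars false

variable {ι : Type*} [Fintype ι] [LinearOrder ι]

/-- `j` is the next coordinate to be extended: among the coordinates outside their terminal
families it minimises `((ν j).card, j)` lexicographically. -/
def IsNext (T : ι → Set (Finset ℕ)) (ν : ι → Finset ℕ) (j : ι) : Prop :=
  ν j ∉ T j ∧ ∀ i, ν i ∉ T i → (ν j).card < (ν i).card ∨ (ν j).card = (ν i).card ∧ j ≤ i

theorem IsNext.unique {T : ι → Set (Finset ℕ)} {ν : ι → Finset ℕ} {i j : ι}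
    (hi : IsNext T ν i) (hj : IsNext T ν j) : i = j := by
  rcases hi.2 j hj.1 with h | h <;> rcases hj.2 i hi.1 with h' | h'
  · omega
  · omega
  · omega
  · exact le_antisymm h.2 h'.2

theorem exists_isNext {T : ι → Set (Finset ℕ)} {ν : ι → Finset ℕ} (h : ∃ j, ν j ∉ T j) :
    ∃ j, IsNext T ν j := by
  classical
  obtain ⟨j, hj, hmin⟩ := Finset.exists_min_image (Finset.univ.filter fun j => ν j ∉ T j)
    (fun j => toLex ((ν j).card, j)) (h.imp fun j hj => by simpa using hj)
  refine ⟨j, by simpa using hj, fun i hi => ?_⟩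
  have := hmin i (by simpa using hi)
  rwa [Prod.Lex.toLex_le_toLex] at this

/-- The tuple `ν` with `n` added to its coordinate `j`. -/
def child (ν : ι → Finset ℕ) (j : ι) (n : ℕ) : ι → Finset ℕ :=
  Function.update ν j (insert n (ν j))

/-- Tuples obtained by enlarging one coordinate. -/
def TupleExt (R : ι → Set (Finset ℕ)) (ν' ν : ι → Finset ℕ) : Prop :=
  ∃ j t, ProperExt (R j) t (ν j) ∧ ν' = Function.update ν j t

/-- Coordinate `i` grows inside `R i`, by integers chosen along `U i`, until it lies in `T i`. -/
structure IsGrowth (R T : ι → Set (Finset ℕ)) (U : ι → Ultrafilter ℕ) : Prop where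
  wf : ∀ i, WellFounded (ProperExt (R i))
  le_atTop : ∀ i, (U i : Filter ℕ) ≤ atTop
  ext : ∀ i, ∀ s ∈ R i, s ∉ T i → ∀ᶠ n in (U i : Filter ℕ), insert n s ∈ R i

variable {R T T' : ι → Set (Finset ℕ)} {U : ι → Ultrafilter ℕ}

/-- The vector of coordinate ranks drops in the product order, which is well-founded since there are
finitely many coordinates. -/
theorem IsGrowth.wf_tupleExt (h : IsGrowth R T U) : WellFounded (TupleExt R) := by
  refine Subrelation.wf (r := InvImage (· < ·)
    (fun (ν : ι → Finset ℕ) (i : ι) => ((h.wf i).apply (ν i)).rank)) ?_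
    (InvImage.wf _ wellFounded_lt)
  rintro ν' ν ⟨j, t, ht, rfl⟩
  have hlt : ((h.wf j).apply t).rank < ((h.wf j).apply (ν j)).rank :=
    Acc.rank_lt_of_rel ((h.wf j).apply (ν j)) ht
  refine Pi.lt_def.2 ⟨fun i => ?_, j, by simpa using hlt⟩
  rcases eq_or_ne i j with rfl | hij
  · simpa using hlt.le
  · simp [Function.update_of_ne hij]

open Classical in
/-- The ultrafilter of the terminal tuples reached from `ν`, by iterating the choices along `U`. -/
noncomputable def leaf (h : IsGrowth R T U) : (ι → Finset ℕ) → Ultrafilter (ι → Finset ℕ) :=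
  h.wf_tupleExt.fix fun ν rec =>
    if hν : ∃ j, IsNext T ν j then
      (U hν.choose).bind fun n =>
        if hn : TupleExt R (child ν hν.choose n) ν then rec _ hn else pure ν
    else pure ν

theorem leaf_of_terminal (h : IsGrowth R T U) {ν : ι → Finset ℕ} (hν : ∀ j, ν j ∈ T j) :
    leaf h ν = pure ν := by
  rw [leaf, WellFounded.fix_eq, dif_neg]
  rintro ⟨j, hj⟩
  exact hj.1 (hν j)

theorem IsGrowth.eventually_child (h : IsGrowth R T U) {ν : ι → Finset ℕ} {j : ι}
    (hν : ν j ∈ R j) (hj : ν j ∉ T j) (N : ℕ) :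
    ∀ᶠ n in (U j : Filter ℕ), insert n (ν j) ∈ R j ∧ N ≤ n ∧ ∀ i, ∀ a ∈ ν i, a < n := by
  have h1 : ∀ᶠ n in (U j : Filter ℕ), ∀ i, ∀ a ∈ ν i, a < n := by
    rw [eventually_all]
    exact fun i => (Filter.eventually_all_finset _).2 fun a _ =>
      h.le_atTop j (eventually_gt_atTop a)
  filter_upwards [h.ext j _ hν hj, h.le_atTop j (eventually_ge_atTop N), h1] with n a b c
  exact ⟨a, b, c⟩

/-- One unfolding of the recursion; the fallback branch `pure ν` for inadmissible `n` is taken only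
on a `U j`-negligible set. -/
theorem eventually_leaf_iff (h : IsGrowth R T U) {ν : ι → Finset ℕ} {j : ι}
    (hν : ν j ∈ R j) (hj : IsNext T ν j) (P : (ι → Finset ℕ) → Prop) :
    (∀ᶠ t in (leaf h ν : Filter (ι → Finset ℕ)), P t) ↔
      ∀ᶠ n in (U j : Filter ℕ), ∀ᶠ t in (leaf h (child ν j n) : Filter (ι → Finset ℕ)), P t := by
  have hex : ∃ j, IsNext T ν j := ⟨j, hj⟩
  have hch : hex.choose = j := hex.choose_spec.unique hj
  conv_lhs => rw [leaf, WellFounded.fix_eq, dif_pos hex]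
  change (∀ᶠ n in (U hex.choose : Filter ℕ), _) ↔ _
  rw [hch]
  refine eventually_congr ?_
  filter_upwards [h.eventually_child hν hj.1 0] with n hn
  have hext : TupleExt R (child ν j n) ν :=
    ⟨j, _, ⟨hn.1, Finset.ssubset_insert fun hmem => (hn.2.2 j n hmem).false⟩, rfl⟩
  rw [dif_pos hext]
  rfl

theorem child_mem {ν : ι → Finset ℕ} (hν : ∀ i, ν i ∈ R i) {j : ι} {n : ℕ}
    (hn : insert n (ν j) ∈ R j) (i : ι) : child ν j n i ∈ R i := by
  rcases eq_or_ne i j with rfl | hij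
  · simpa [child] using hn
  · simpa [child, Function.update_of_ne hij] using hν i

theorem IsGrowth.induction (h : IsGrowth R T U) {Q : (ι → Finset ℕ) → Prop}
    (terminal : ∀ ν, (∀ i, ν i ∈ R i) → (∀ j, ν j ∈ T j) → Q ν)
    (step : ∀ ν j, (∀ i, ν i ∈ R i) → IsNext T ν j →
      (∀ᶠ n in (U j : Filter ℕ), insert n (ν j) ∈ R j ∧ (∀ i, ∀ a ∈ ν i, a < n) ∧
        Q (child ν j n)) → Q ν)
    (ν : ι → Finset ℕ) (hν : ∀ i, ν i ∈ R i) : Q ν := by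
  induction ν using h.wf_tupleExt.induction with
  | _ ν ih =>
    by_cases hT : ∀ j, ν j ∈ T j
    · exact terminal ν hν hT
    · push Not at hT
      obtain ⟨j, hj⟩ := exists_isNext hT
      refine step ν j hν hj ?_
      filter_upwards [h.eventually_child (hν j) hj.1 0] with n hn
      refine ⟨hn.1, hn.2.2, ih _ ⟨j, _, ⟨hn.1, Finset.ssubset_insert fun hmem =>
        (hn.2.2 j n hmem).false⟩, rfl⟩ (child_mem hν hn.1)⟩

theorem eventually_leaf_of_invariant (h : IsGrowth R T U) {I : (ι → Finset ℕ) → Prop}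
    (hI : ∀ ν j, (∀ i, ν i ∈ R i) → IsNext T ν j → I ν →
      ∀ᶠ n in (U j : Filter ℕ), (∀ i, ∀ a ∈ ν i, a < n) → I (child ν j n))
    {ν : ι → Finset ℕ} (hν : ∀ i, ν i ∈ R i) (hIν : I ν) :
    ∀ᶠ t in (leaf h ν : Filter (ι → Finset ℕ)), I t ∧ (∀ i, t i ∈ R i) ∧ ∀ i, t i ∈ T i := by
  revert hIν
  refine h.induction (Q := fun ν => I ν → ∀ᶠ t in (leaf h ν : Filter (ι → Finset ℕ)),
    I t ∧ (∀ i, t i ∈ R i) ∧ ∀ i, t i ∈ T i) ?_ ?_ ν hν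
  · intro ν hν hT hI
    rw [leaf_of_terminal h hT]
    exact ⟨hI, hν, hT⟩
  · intro ν j hν hj ih hIν
    rw [eventually_leaf_iff h (hν j) hj]
    filter_upwards [ih, hI ν j hν hj hIν] with n hn hn'
    exact hn.2.2 (hn' hn.2.1)

/-- Plegma tuples: the elements are ordered lexicographically by (position, coordinate). -/
def Plegma (s : ι → Finset ℕ) : Prop :=
  ∀ i j, ∀ a ∈ s i, ∀ b ∈ s j,
    (pos (s i) a < pos (s j) b ∨ pos (s i) a = pos (s j) b ∧ i < j) → a < b

theorem Plegma.eq_of_mem {s : ι → Finset ℕ} (hs : Plegma s) {i j : ι} {a : ℕ} (hi : a ∈ s i)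
    (hj : a ∈ s j) : i = j := by
  by_contra hij
  rcases lt_trichotomy (pos (s i) a) (pos (s j) a) with h | h | h
  · exact (hs i j a hi a hj (Or.inl h)).false
  · rcases lt_or_gt_of_ne hij with h' | h'
    · exact (hs i j a hi a hj (Or.inr ⟨h, h'⟩)).false
    · exact (hs j i a hj a hi (Or.inr ⟨h.symm, h'⟩)).false
  · exact (hs j i a hj a hi (Or.inl h)).false

/-- Since `n` exceeds every earlier element, only pairs requiring `n` to be the smaller one could
fail; the cardinality condition rules out any old element in a later slot. -/
theorem Plegma.child {ν : ι → Finset ℕ} (hν : Plegma ν) {j : ι} {n : ℕ}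
    (hn : ∀ i, ∀ a ∈ ν i, a < n)
    (hcard : ∀ i, (i ≤ j → (ν i).card ≤ (ν j).card + 1) ∧ (j < i → (ν i).card ≤ (ν j).card)) :
    Plegma (child ν j n) := by
  have hpos : ∀ i a, a ≤ n → pos (_root_.child ν j n i) a = pos (ν i) a := by
    intro i a ha
    rcases eq_or_ne i j with rfl | hij
    · simp only [_root_.child, Function.update_self, pos]
      rw [Finset.filter_insert, if_neg (by omega)]
    · simp [_root_.child, Function.update_of_ne hij]
  have hmem : ∀ i a, a ∈ _root_.child ν j n i → a ∈ ν i ∨ (i = j ∧ a = n) := by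
    intro i a ha
    rcases eq_or_ne i j with rfl | hij
    · simp only [_root_.child, Function.update_self, Finset.mem_insert] at ha
      tauto
    · simp only [_root_.child, Function.update_of_ne hij] at ha
      exact Or.inl ha
  have hle : ∀ i a, a ∈ _root_.child ν j n i → a ≤ n := fun i a ha =>
    (hmem i a ha).elim (fun h => (hn i a h).le) fun h => h.2.le
  intro i i' a ha b hb hab
  rw [hpos i a (hle i a ha), hpos i' b (hle i' b hb)] at hab
  rcases hmem i a ha with ha' | ⟨rfl, rfl⟩
  · rcases hmem i' b hb with hb' | ⟨rfl, rfl⟩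
    · exact hν i i' a ha' b hb' hab
    · exact hn i a ha'
  · exfalso
    rw [pos_of_forall_lt (hn i)] at hab
    rcases hmem i' b hb with hb' | ⟨rfl, rfl⟩
    · have h1 := pos_lt_card hb'
      have h2 := hcard i'
      rcases lt_or_ge i i' with h | h
      · have := h2.2 h
        omega
      · have h3 := h2.1 h
        rcases hab with hab | hab
        · omega
        · exact (hab.2.trans_le h).false
    · rw [pos_of_forall_lt (hn i')] at hab
      simp at hab

/-- The balance of the cardinalities kept by the growth process. -/
def BalancedCard (T : ι → Set (Finset ℕ)) (ν : ι → Finset ℕ) : Prop :=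
  ∀ j, ν j ∉ T j → ∀ i, (i ≤ j → (ν i).card ≤ (ν j).card + 1) ∧ (j < i → (ν i).card ≤ (ν j).card)

theorem BalancedCard.child {ν : ι → Finset ℕ} (hν : BalancedCard T ν) {j : ι} (hj : IsNext T ν j) {n : ℕ}
    (hn : n ∉ ν j) : BalancedCard T (child ν j n) := by
  intro k hk i
  have hc : (insert n (ν j)).card = (ν j).card + 1 := Finset.card_insert_of_notMem hn
  rcases eq_or_ne k j with rfl | hkj
  · have h := hν k hj.1 i
    rcases eq_or_ne i k with rfl | hik
    · simp [_root_.child]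
    · simp only [_root_.child, Function.update_self, Function.update_of_ne hik, hc]
      exact ⟨fun h' => (h.1 h').trans (by omega), fun h' => (h.2 h').trans (by omega)⟩
  · have hkT : ν k ∉ T k := by simpa [_root_.child, Function.update_of_ne hkj] using hk
    have h := hν k hkT i
    rcases eq_or_ne i j with rfl | hij
    · simp only [_root_.child, Function.update_self, Function.update_of_ne hkj, hc]
      rcases hj.2 k hkT with h1 | ⟨h1, h2⟩
      · exact ⟨fun _ => by omega, fun _ => by omega⟩
      · exact ⟨fun _ => by omega, fun h' => absurd h2 (not_le.2 h')⟩
    · simpa only [_root_.child, Function.update_of_ne hij, Function.update_of_ne hkj] using h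

/-- Balance of cardinalities holds at the empty tuple and persists, so the filling order is the
plegma order. The clause on `∅ ∈ T i` is meant for coordinates frozen from the start. -/
theorem eventually_leaf_empty (h : IsGrowth R T U) (hR : ∀ i, ∅ ∈ R i) (N : ℕ) :
    ∀ᶠ t in (leaf h (fun _ => ∅) : Filter (ι → Finset ℕ)),
      Plegma t ∧ (∀ i, ∀ a ∈ t i, N ≤ a) ∧ (∀ i, ∅ ∈ T i → t i = ∅) ∧ (∀ i, t i ∈ R i) ∧
        ∀ i, t i ∈ T i := by
  have := eventually_leaf_of_invariant h (I := fun t => (Plegma t ∧ BalancedCard T t) ∧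
    (∀ i, ∀ a ∈ t i, N ≤ a) ∧ ∀ i, ∅ ∈ T i → t i = ∅) ?_ (ν := fun _ => ∅) hR ?_
  · filter_upwards [this] with t ht
    exact ⟨ht.1.1.1, ht.1.2.1, ht.1.2.2, ht.2⟩
  · rintro ν j hν hj ⟨⟨h1, h2⟩, h3, h4⟩
    filter_upwards [h.le_atTop j (eventually_ge_atTop N)] with n hN hn
    refine ⟨⟨h1.child hn (h2 j hj.1), h2.child hj fun hmem => (hn j n hmem).false⟩, ?_, ?_⟩
    · intro i a ha
      rcases eq_or_ne i j with rfl | hij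
      · simp only [child, Function.update_self, Finset.mem_insert] at ha
        rcases ha with rfl | ha
        · exact hN
        · exact h3 i a ha
      · simp only [child, Function.update_of_ne hij] at ha
        exact h3 i a ha
    · intro i hi
      have hij : i ≠ j := by
        rintro rfl
        exact hj.1 (h4 i hi ▸ hi)
      simpa only [child, Function.update_of_ne hij] using h4 i hi
  · refine ⟨⟨?_, ?_⟩, ?_, ?_⟩
    · intro i j a ha
      simp at ha
    · intro j _ i
      simp
    · simp
    · simp

/-- A coordinate which is never extended does not influence the process. -/
theorem eventually_leaf_update (h : IsGrowth R T U) {q : ι} (hq : T q = Set.univ)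
    {s : Finset ℕ} (hs : s ∈ R q) {ν : ι → Finset ℕ} (hν : ∀ i, ν i ∈ R i) :
    ∀ P : (ι → Finset ℕ) → Prop,
      (∀ᶠ t in (leaf h (Function.update ν q s) : Filter (ι → Finset ℕ)), P t) ↔
        ∀ᶠ t in (leaf h ν : Filter (ι → Finset ℕ)), P (Function.update t q s) := by
  refine h.induction (Q := fun ν => ∀ P : (ι → Finset ℕ) → Prop,
      (∀ᶠ t in (leaf h (Function.update ν q s) : Filter (ι → Finset ℕ)), P t) ↔
        ∀ᶠ t in (leaf h ν : Filter (ι → Finset ℕ)), P (Function.update t q s)) ?_ ?_ ν hν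
  · intro ν hν hT P
    rw [leaf_of_terminal h hT, leaf_of_terminal h]
    · rfl
    · intro i
      rcases eq_or_ne i q with rfl | hiq
      · simp [hq]
      · simpa [Function.update_of_ne hiq] using hT i
  · intro ν j hν hj ih P
    have hjq : j ≠ q := by
      rintro rfl
      exact hj.1 (by simp [hq])
    have hj' : IsNext T (Function.update ν q s) j := by
      refine ⟨by simpa [Function.update_of_ne hjq] using hj.1, fun i hi => ?_⟩
      have hiq : i ≠ q := by
        rintro rfl
        exact hi (by simp [hq])
      simp only [Function.update_of_ne hiq, Function.update_of_ne hjq] at hi ⊢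
      exact hj.2 i hi
    rw [eventually_leaf_iff h (by simpa [Function.update_of_ne hjq] using hν j) hj',
      eventually_leaf_iff h (hν j) hj]
    refine eventually_congr ?_
    filter_upwards [ih] with n hn
    have : child (Function.update ν q s) j n = Function.update (child ν j n) q s := by
      simp only [child, Function.update_of_ne hjq]
      exact Function.update_comm hjq.symm _ _ _
    rw [this]
    exact hn.2.2 P

end Growth

/-! ### Limits of norms along the leaves -/

section LeafValue

set_option linter.unusedSectionVars false

variable {ι : Type*} [Fintype ι] [LinearOrder ι] {X : Type*} [NormedAddCommGroup X]
  [NormedSpace ℝ X] {R T T' : ι → Set (Finset ℕ)} {U : ι → Ultrafilter ℕ}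

/-- Mazur's theorem, by Hahn–Banach separation. -/
theorem mem_of_weak_tendsto {α : Type*} {l : Filter α} [NeBot l] {K : Set X} (hc : Convex ℝ K)
    (hK : IsClosed K) {v : α → X} {x : X} (hv : ∀ᶠ n in l, v n ∈ K)
    (h : ∀ f : X →L[ℝ] ℝ, Tendsto (fun n => f (v n)) l (𝓝 (f x))) : x ∈ K := by
  by_contra hx
  obtain ⟨f, u, hfu, hux⟩ := geometric_hahn_banach_closed_point hc hK hx
  have : f x ≤ u := le_of_tendsto (h f) (hv.mono fun n hn => (hfu _ hn).le)
  exact hux.not_ge this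

/-- The limit superior of `N` is at most `r`. -/
def LimLE {σ : Type*} (l : Filter σ) (N : σ → ℝ) (r : ℝ) : Prop :=
  ∀ r' > r, ∀ᶠ t in l, N t ≤ r'

theorem convex_limLE {σ : Type*} (l : Filter σ) (w : σ → X) (r : ℝ) :
    Convex ℝ {u | LimLE l (fun t => ‖w t + u‖) r} := by
  intro u hu v hv a b ha hb hab r' hr'
  filter_upwards [hu r' hr', hv r' hr'] with t h1 h2
  have : w t + (a • u + b • v) = a • (w t + u) + b • (w t + v) := by
    have : w t = a • w t + b • w t := by rw [← add_smul, hab, one_smul]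
    nth_rw 1 [this]
    simp only [smul_add]
    abel
  rw [this]
  refine (norm_add_le _ _).trans ?_
  rw [norm_smul, norm_smul, Real.norm_of_nonneg ha, Real.norm_of_nonneg hb]
  have e : r' = a * r' + b * r' := by rw [← add_mul, hab, one_mul]
  rw [e]
  exact add_le_add (mul_le_mul_of_nonneg_left h1 ha) (mul_le_mul_of_nonneg_left h2 hb)

theorem isClosed_limLE {σ : Type*} (l : Filter σ) (w : σ → X) (r : ℝ) :
    IsClosed {u | LimLE l (fun t => ‖w t + u‖) r} := by
  refine isClosed_of_closure_subset fun u hu r' hr' => ?_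
  obtain ⟨v, hv, huv⟩ := Metric.mem_closure_iff.1 hu ((r' - r) / 2) (by linarith)
  filter_upwards [hv (r + (r' - r) / 2) (by linarith)] with t ht
  have : w t + u = (w t + v) + (u - v) := by abel
  rw [this]
  rw [dist_eq_norm] at huv
  exact (norm_add_le _ _).trans (by linarith)

theorem IsGrowth.of_subset (h : IsGrowth R T U) (hT : ∀ i, T i ⊆ T' i) : IsGrowth R T' U where
  wf := h.wf
  le_atTop := h.le_atTop
  ext i s hs hs' := h.ext i s hs fun hsT => hs' (hT i hsT)

theorem norm_sum_update (g : ι → Finset ℕ → X) (t : ι → Finset ℕ) (q : ι) (s : Finset ℕ) :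
    ∑ i, g i (Function.update t q s i) = ∑ i ∈ Finset.univ.erase q, g i (t i) + g q s := by
  rw [← Finset.sum_erase_add _ _ (Finset.mem_univ q), Function.update_self]
  congr 1
  refine Finset.sum_congr rfl fun i hi => ?_
  rw [Function.update_of_ne (Finset.ne_of_mem_erase hi)]

/-- Not extending the coordinates along which the vectors converge weakly does not increase the
limit of the norms. -/
theorem LimLE.freeze (h : IsGrowth R T U) (h' : IsGrowth R T' U)
    (hT : ∀ i, T' i = T i ∨ T' i = Set.univ) (g : ι → Finset ℕ → X)
    (hg : ∀ i, T' i = Set.univ → ∀ s ∈ R i, s ∉ T i → ∀ f : X →L[ℝ] ℝ,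
      Tendsto (fun n => f (g i (insert n s))) (U i : Filter ℕ) (𝓝 (f (g i s))))
    {ν : ι → Finset ℕ} (hν : ∀ i, ν i ∈ R i) :
    ∀ r, LimLE (leaf h ν : Filter (ι → Finset ℕ)) (fun t => ‖∑ i, g i (t i)‖) r →
      LimLE (leaf h' ν : Filter (ι → Finset ℕ)) (fun t => ‖∑ i, g i (t i)‖) r := by
  refine h.induction (Q := fun ν => ∀ r,
    LimLE (leaf h ν : Filter (ι → Finset ℕ)) (fun t => ‖∑ i, g i (t i)‖) r →
      LimLE (leaf h' ν : Filter (ι → Finset ℕ)) (fun t => ‖∑ i, g i (t i)‖) r) ?_ ?_ ν hν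
  · intro ν hν hνT r hr
    rw [leaf_of_terminal h hνT] at hr
    rw [leaf_of_terminal h']
    · exact hr
    · intro i
      rcases hT i with hi | hi
      · exact hi ▸ hνT i
      · simp [hi]
  · intro ν j hν hj ih r hr
    -- The slack from `r` to `r'` is needed because the set of good `n` depends on the tolerance.
    have key : ∀ r' > r, ∀ᶠ n in (U j : Filter ℕ), insert n (ν j) ∈ R j ∧
        LimLE (leaf h' (child ν j n) : Filter (ι → Finset ℕ)) (fun t => ‖∑ i, g i (t i)‖) r' := by
      intro r' hr'
      obtain ⟨r₁, h1, h2⟩ := exists_between hr'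
      have := (eventually_leaf_iff h (hν j) hj _).1 (hr r₁ h1)
      have hlim : ∀ᶠ n in (U j : Filter ℕ),
          LimLE (leaf h (child ν j n) : Filter (ι → Finset ℕ)) (fun t => ‖∑ i, g i (t i)‖) r' := by
        filter_upwards [this] with n hn r'' hr''
        exact hn.mono fun t ht => ht.trans (h2.trans hr'').le
      filter_upwards [hlim, ih] with n hn hn'
      exact ⟨hn'.1, hn'.2.2 r' hn⟩
    by_cases hjT : ν j ∈ T' j
    · have hTj : T' j = Set.univ := (hT j).resolve_left fun h => hj.1 (h ▸ hjT)
      have hself : ∀ P : (ι → Finset ℕ) → Prop,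
          (∀ᶠ t in (leaf h' ν : Filter (ι → Finset ℕ)), P t) ↔
            ∀ᶠ t in (leaf h' ν : Filter (ι → Finset ℕ)), P (Function.update t j (ν j)) := by
        intro P
        have := eventually_leaf_update h' hTj (hν j) hν P
        rwa [Function.update_eq_self] at this
      -- With `j` frozen, the leaves above a child differ from those above `ν` only in coordinate
      -- `j`. So almost all vectors `g j (insert n (ν j))` lie in one closed convex set, which then
      -- contains their weak limit.
      have hmem : ∀ r' > r, g j (ν j) ∈ {u | LimLE (leaf h' ν : Filter (ι → Finset ℕ))
          (fun t => ‖∑ i ∈ Finset.univ.erase j, g i (t i) + u‖) r'} := by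
        intro r' hr'
        refine mem_of_weak_tendsto (convex_limLE _ _ r') (isClosed_limLE _ _ r')
          (l := (U j : Filter ℕ)) ?_ (hg j hTj _ (hν j) hj.1)
        filter_upwards [key r' hr'] with n hn r'' hr''
        have := hn.2 r'' hr''
        rw [child, eventually_leaf_update h' hTj hn.1 hν] at this
        simpa only [norm_sum_update] using this
      intro r' hr'
      obtain ⟨r₁, h1, h2⟩ := exists_between hr'
      have := hmem r₁ h1 r' h2
      rw [hself]
      simpa only [norm_sum_update] using this
    · have hTj : T' j = T j := (hT j).resolve_right fun h => hjT (by simp [h])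
      have hj' : IsNext T' ν j := by
        refine ⟨hjT, fun i hi => hj.2 i ?_⟩
        have : T' i = T i := (hT i).resolve_right fun h => hi (by simp [h])
        exact this ▸ hi
      intro r' hr'
      obtain ⟨r₁, h1, h2⟩ := exists_between hr'
      rw [eventually_leaf_iff h' (hν j) hj']
      filter_upwards [key r₁ h1] with n hn
      exact hn.2 r' h2

theorem abs_norm_sum_sub_le {C η : ℝ} {y : ι → X} (hy : ∀ i, ‖y i‖ ≤ C) (c c' : ι → ℝ)
    (hcc : ∀ i, |c i - c' i| ≤ η) :
    |‖∑ i, c i • y i‖ - ‖∑ i, c' i • y i‖| ≤ Fintype.card ι * (η * C) := by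
  refine (abs_norm_sub_norm_le _ _).trans ?_
  rw [← Finset.sum_sub_distrib]
  refine (norm_sum_le _ _).trans ((Finset.sum_le_card_nsmul _ _ (η * C) fun i _ => ?_).trans_eq ?_)
  · rw [← sub_smul, norm_smul]
    have h0 : 0 ≤ η := (abs_nonneg _).trans (hcc i)
    exact mul_le_mul (hcc i) (hy i) (norm_nonneg _) h0
  · simp [Finset.card_univ]

/-- `v c` is the limit of `‖∑ i, c i • y i t‖`, uniformly for coefficients in `[-1, 1]`. -/
def IsUniformValue {σ : Type*} (l : Filter σ) (y : ι → σ → X) (v : (ι → ℝ) → ℝ) : Prop :=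
  ∀ ε > 0, ∀ᶠ t in l, ∀ c : ι → ℝ, (∀ i, |c i| ≤ 1) → |‖∑ i, c i • y i t‖ - v c| ≤ ε

/-- Pointwise limits exist by compactness; they are Lipschitz in the coefficients, so a finite net
of the cube gives uniformity. Uniformity is what later leaves only finitely many conditions per
stage. -/
theorem exists_isUniformValue {σ : Type*} (l : Ultrafilter σ) (y : ι → σ → X) {C : ℝ}
    (hC : ∀ᶠ t in (l : Filter σ), ∀ i, ‖y i t‖ ≤ C) :
    ∃ v, IsUniformValue (l : Filter σ) y v := by
  have hlim : ∀ c : ι → ℝ, ∃ v, Tendsto (fun t => ‖∑ i, c i • y i t‖) (l : Filter σ) (𝓝 v) := by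
    intro c
    have hmem : Set.Icc 0 (∑ i, |c i| * C) ∈ (l.map fun t => ‖∑ i, c i • y i t‖ : Filter ℝ) := by
      change ∀ᶠ t in (l : Filter σ), _
      filter_upwards [hC] with t ht
      refine ⟨norm_nonneg _, (norm_sum_le _ _).trans (Finset.sum_le_sum fun i _ => ?_)⟩
      rw [norm_smul]
      exact mul_le_mul_of_nonneg_left (ht i) (abs_nonneg _)
    obtain ⟨v, -, hv⟩ := isCompact_Icc.ultrafilter_le_nhds'
      (l.map fun t => ‖∑ i, c i • y i t‖) hmem
    exact ⟨v, hv⟩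
  choose v hv using hlim
  refine ⟨v, fun ε hε => ?_⟩
  obtain ⟨η, hη, hηC⟩ : ∃ η > 0, Fintype.card ι * (η * C) ≤ ε / 3 := by
    have hD : 0 < Fintype.card ι * |C| + 1 := by positivity
    -- The added 1 keeps the denominator positive when `C = 0` or `ι` is empty.
    refine ⟨ε / 3 / (Fintype.card ι * |C| + 1), by positivity, ?_⟩
    have h1 : (Fintype.card ι : ℝ) * (ε / 3 / (Fintype.card ι * |C| + 1) * C) ≤
        (ε / 3 / (Fintype.card ι * |C| + 1)) * (Fintype.card ι * |C|) := by
      have : (Fintype.card ι : ℝ) * C ≤ Fintype.card ι * |C| := by gcongr; exact le_abs_self C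
      have h2 : 0 ≤ ε / 3 / (Fintype.card ι * |C| + 1) := by positivity
      nlinarith
    refine h1.trans ?_
    rw [div_mul_eq_mul_div, div_le_iff₀ hD]
    nlinarith [abs_nonneg C]
  have hlip : ∀ c c' : ι → ℝ, (∀ i, |c i - c' i| ≤ η) → |v c - v c'| ≤ ε / 3 := by
    intro c c' hcc
    refine le_of_tendsto (((hv c).sub (hv c')).abs) ?_
    filter_upwards [hC] with t ht
    exact (abs_norm_sum_sub_le ht c c' hcc).trans hηC
  have hcomp : IsCompact (Metric.closedBall (0 : ι → ℝ) 1) := isCompact_closedBall _ _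
  obtain ⟨S, -, hSf, hS⟩ := hcomp.finite_cover_balls hη
  have hnet : ∀ᶠ t in (l : Filter σ), ∀ c ∈ S, |‖∑ i, c i • y i t‖ - v c| < ε / 3 := by
    rw [Filter.eventually_all_finite hSf]
    intro c _
    have := Metric.tendsto_nhds.1 (hv c) (ε / 3) (by positivity)
    simpa only [Real.dist_eq] using this
  filter_upwards [hnet, hC] with t ht htC c hc
  have hcb : c ∈ Metric.closedBall (0 : ι → ℝ) 1 := by
    rw [mem_closedBall_zero_iff, pi_norm_le_iff_of_nonneg zero_le_one]
    exact hc
  obtain ⟨c', hc', hcc'⟩ := Set.mem_iUnion₂.1 (hS hcb)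
  have hcc : ∀ i, |c i - c' i| ≤ η := fun i => by
    have h := Metric.mem_ball.1 hcc'
    rw [dist_eq_norm] at h
    exact (norm_le_pi_norm (c - c') i).trans h.le
  have h1 := (abs_norm_sum_sub_le htC c c' hcc).trans hηC
  have h2 := hlip c c' hcc
  have h3 := ht c' hc'
  rw [abs_le] at h1 h2 ⊢
  rw [abs_lt] at h3
  constructor <;> linarith

/-- The limit of the norms of the linear combinations along the leaves above `ν`. -/
noncomputable def leafValue (h : IsGrowth R T U) (g : ι → Finset ℕ → X) (ν : ι → Finset ℕ) :
    (ι → ℝ) → ℝ :=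
  Classical.epsilon fun v =>
    IsUniformValue (leaf h ν : Filter (ι → Finset ℕ)) (fun i t => g i (t i)) v

variable {g : ι → Finset ℕ → X} {C : ℝ}

theorem leafValue_spec (h : IsGrowth R T U) (hC : ∀ i, ∀ s ∈ R i, s ∈ T i → ‖g i s‖ ≤ C)
    {ν : ι → Finset ℕ} (hν : ∀ i, ν i ∈ R i) :
    IsUniformValue (leaf h ν : Filter (ι → Finset ℕ)) (fun i t => g i (t i))
      (leafValue h g ν) := by
  refine Classical.epsilon_spec (exists_isUniformValue (C := C) _ _ ?_)
  have := eventually_leaf_of_invariant h (I := fun _ => True)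
    (fun _ _ _ _ _ => Eventually.of_forall fun _ _ => trivial) hν trivial
  filter_upwards [this] with t ht i
  exact hC i _ (ht.2.1 i) (ht.2.2 i)

theorem leafValue_of_terminal (h : IsGrowth R T U)
    (hC : ∀ i, ∀ s ∈ R i, s ∈ T i → ‖g i s‖ ≤ C) {ν : ι → Finset ℕ} (hν : ∀ i, ν i ∈ R i)
    (hνT : ∀ i, ν i ∈ T i) {c : ι → ℝ} (hc : ∀ i, |c i| ≤ 1) :
    leafValue h g ν c = ‖∑ i, c i • g i (ν i)‖ := by
  have hs := leafValue_spec h hC hν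
  refine (sub_eq_zero.1 (abs_nonpos_iff.1 (le_of_forall_pos_le_add fun ε hε => ?_))).symm
  have := hs ε hε
  rw [leaf_of_terminal h hνT] at this
  have h2 : ∀ c : ι → ℝ, (∀ i, |c i| ≤ 1) →
    |‖∑ i, c i • g i (ν i)‖ - leafValue h g ν c| ≤ ε := this
  simpa using h2 c hc

/-- For almost all `n`, some leaf above the child approximates both values within ε/2. -/
theorem eventually_leafValue_child (h : IsGrowth R T U)
    (hC : ∀ i, ∀ s ∈ R i, s ∈ T i → ‖g i s‖ ≤ C) {ν : ι → Finset ℕ} (hν : ∀ i, ν i ∈ R i)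
    {j : ι} (hj : IsNext T ν j) {ε : ℝ} (hε : 0 < ε) :
    ∀ᶠ n in (U j : Filter ℕ), ∀ c : ι → ℝ, (∀ i, |c i| ≤ 1) →
      |leafValue h g (child ν j n) c - leafValue h g ν c| ≤ ε := by
  have h1 := (eventually_leaf_iff h (hν j) hj _).1 (leafValue_spec h hC hν (ε / 2) (half_pos hε))
  filter_upwards [h1, h.eventually_child (hν j) hj.1 0] with n hn hn' c hc
  obtain ⟨t, ht, ht'⟩ :=
    (hn.and (leafValue_spec h hC (child_mem hν hn'.1) (ε / 2) (half_pos hε))).exists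
  have h1 := ht c hc
  have h2 := ht' c hc
  rw [abs_le] at h1 h2 ⊢
  constructor <;> linarith

/-- Along a sequence `m` respecting the process, the norms at plegma tuples are close to the value
of the process. -/
theorem abs_norm_sub_leafValue_le (h : IsGrowth R T U)
    (hC : ∀ i, ∀ s ∈ R i, s ∈ T i → ‖g i s‖ ≤ C) (hher : ∀ i, ∀ s ∈ R i, ∀ t ⊆ s, t ∈ R i)
    (hanti : ∀ i, ∀ s ∈ T i, ∀ t ⊂ s, t ∉ T i) {m : ℕ → ℕ} (hm : StrictMono m)
    {J : ℕ → ι → Prop} {l : ℕ} (hstep : ∀ i ≥ l, ∀ ν : ι → Finset ℕ, (∀ q, ν q ∈ R q) →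
      (∀ q, ν q ⊆ (Finset.range i).image m) → ∀ j, J i j → IsNext T ν j →
      ∀ c : ι → ℝ, (∀ q, |c q| ≤ 1) →
        |leafValue h g (child ν j (m i)) c - leafValue h g ν c| ≤ (1 / 2) ^ i)
    {t : ι → Finset ℕ} (ht : Plegma t) (htR : ∀ q, t q ∈ R q) (htT : ∀ q, t q ∈ T q)
    (htm : ∀ q, ∀ a ∈ t q, ∃ i ≥ l, J i q ∧ a = m i) {c : ι → ℝ} (hc : ∀ q, |c q| ≤ 1) :
    |‖∑ q, c q • g q (t q)‖ - leafValue h g (fun _ => ∅) c| ≤ 2 * (1 / 2) ^ l := by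
  set ν : ℕ → ι → Finset ℕ := fun i q => (t q).filter (· < m i) with hνdef
  have hνR : ∀ i q, ν i q ∈ R q := fun i q => hher q _ (htR q) _ (Finset.filter_subset _ _)
  have hνl : ν l = fun _ => ∅ := by
    funext q
    refine Finset.filter_eq_empty_iff.2 fun a ha => ?_
    obtain ⟨i, hi, -, rfl⟩ := htm q a ha
    exact not_lt.2 (hm.monotone hi)
  obtain ⟨I, hI⟩ : ∃ I, ∀ q, ∀ a ∈ t q, a < m I := by
    refine ⟨(Finset.univ.sup fun q => (t q).sup id) + 1, fun q a ha => ?_⟩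
    have h1 : a ≤ (t q).sup id := Finset.le_sup (f := id) ha
    have h2 : (t q).sup id ≤ Finset.univ.sup fun q => (t q).sup id :=
      Finset.le_sup (f := fun q => (t q).sup id) (Finset.mem_univ q)
    exact (Nat.lt_succ_of_le (h1.trans h2)).trans_le (hm.id_le _)
  -- Backward induction from a stage `I` past the whole tuple. Passing from stage `i` to `i + 1`
  -- costs at most (1/2)^i, and these costs sum to 2 (1/2)^i from `i` on.
  have main : ∀ d i, l ≤ i → I ≤ i + d →
      |‖∑ q, c q • g q (t q)‖ - leafValue h g (ν i) c| ≤ 2 * (1 / 2) ^ i := by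
    intro d
    induction d with
    | zero =>
      intro i hi hIi
      have : ν i = t := by
        funext q
        exact Finset.filter_true_of_mem fun a ha => (hI q a ha).trans_le (hm.monotone hIi)
      rw [this, leafValue_of_terminal h hC htR htT hc]
      simp
    | succ d ih =>
      intro i hi hIi
      have hs : ∀ q a, a ∈ t q → (a < m (i + 1) ↔ a < m i ∨ a = m i) := by
        intro q a ha
        obtain ⟨i', hi', -, rfl⟩ := htm q a ha
        rw [hm.lt_iff_lt, hm.lt_iff_lt, hm.injective.eq_iff]
        omega
      have hnext := ih (i + 1) (hi.trans (Nat.le_succ i)) (by omega)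
      have hpow : (2 : ℝ) * (1 / 2) ^ (i + 1) + (1 / 2) ^ i = 2 * (1 / 2) ^ i := by ring
      by_cases hq : ∃ q, m i ∈ t q
      · obtain ⟨q, hq⟩ := hq
        have hJ : J i q := by
          obtain ⟨i', -, hJ, h'⟩ := htm q _ hq
          rwa [hm.injective h']
        have hchild : ν (i + 1) = child (ν i) q (m i) := by
          funext q'
          ext a
          rcases eq_or_ne q' q with rfl | hqq
          · simp only [hνdef, child, Function.update_self, Finset.mem_insert, Finset.mem_filter]
            constructor
            · rintro ⟨ha, hlt⟩
              rcases (hs q' a ha).1 hlt with h1 | h1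
              · exact Or.inr ⟨ha, h1⟩
              · exact Or.inl h1
            · rintro (rfl | ⟨ha, hlt⟩)
              · exact ⟨hq, hm (Nat.lt_succ_self i)⟩
              · exact ⟨ha, (hs q' a ha).2 (Or.inl hlt)⟩
          · simp only [hνdef, child, Function.update_of_ne hqq, Finset.mem_filter]
            refine and_congr_right fun ha => ?_
            rw [hs q' a ha]
            refine or_iff_left fun h' => hqq ?_
            exact ht.eq_of_mem (h' ▸ ha) hq
        -- If an unfinished `q'` preceded `q`, its first missing element `b` would occupy an earlier
        -- plegma slot than `m i`, hence be smaller and not missing.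
        have hisNext : IsNext T (ν i) q := by
          refine ⟨hanti q _ (htT q) _ (Finset.filter_ssubset.2 ⟨m i, hq, lt_irrefl _⟩), ?_⟩
          intro q' hq'
          obtain ⟨b₀, hb₀, hb₀i⟩ : ∃ b ∈ t q', ¬ b < m i := by
            by_contra! hall
            have e : ν i q' = t q' := Finset.filter_true_of_mem hall
            exact hq' (e.symm ▸ htT q')
          have hne : ((t q').filter fun b => ¬ b < m i).Nonempty :=
            ⟨b₀, Finset.mem_filter.2 ⟨hb₀, hb₀i⟩⟩
          set b := ((t q').filter fun b => ¬ b < m i).min' hne with hbdef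
          have hb := Finset.mem_filter.1 (Finset.min'_mem _ hne)
          rw [← hbdef] at hb
          have hbc : pos (t q') b = (ν i q').card := by
            refine congrArg Finset.card (Finset.filter_congr fun a ha => ?_)
            refine ⟨fun hab => ?_, fun hai => hai.trans_le (not_lt.1 hb.2)⟩
            by_contra hai
            exact hab.not_ge (Finset.min'_le _ _ (Finset.mem_filter.2 ⟨ha, hai⟩))
          have hqc : pos (t q) (m i) = (ν i q).card := rfl
          by_contra hcon
          have hlt : b < m i := by
            refine ht q' q b hb.1 (m i) hq ?_
            rw [hbc, hqc]
            by_contra hcon'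
            push Not at hcon hcon'
            rcases lt_trichotomy (ν i q).card (ν i q').card with h1 | h1 | h1
            · exact hcon.1.not_gt h1
            · exact (hcon.2 h1).not_ge (hcon'.2 h1.symm)
            · exact hcon'.1.not_gt h1
          exact hb.2 hlt
        have hsub : ∀ q', ν i q' ⊆ (Finset.range i).image m := by
          intro q' a ha
          obtain ⟨ha, hlt⟩ := Finset.mem_filter.1 ha
          obtain ⟨i', -, -, rfl⟩ := htm q' a ha
          exact Finset.mem_image_of_mem _ (Finset.mem_range.2 (hm.lt_iff_lt.1 hlt))
        have h1 := hstep i hi (ν i) (hνR i) hsub q hJ hisNext c hc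
        rw [← hchild] at h1
        rw [← hpow]
        rw [abs_le] at h1 hnext ⊢
        constructor <;> linarith
      · have : ν (i + 1) = ν i := by
          funext q
          refine Finset.filter_congr fun a ha => ?_
          rw [hs q a ha]
          exact or_iff_left fun h' => hq ⟨q, h' ▸ ha⟩
        rw [this] at hnext
        refine hnext.trans ?_
        rw [← hpow]
        have : (0 : ℝ) < (1 / 2) ^ i := by positivity
        linarith
  have := main I l le_rfl (by omega)
  rwa [hνl] at this

end LeafValue

/-! ### Diagonal selection along a sequence of filters -/

theorem exists_strictMono_selection {l : ℕ → Filter ℕ} [∀ i, NeBot (l i)] (hl : ∀ i, l i ≤ atTop)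
    {P : ℕ → Finset ℕ → ℕ → Prop} (hP : ∀ i A, ∀ᶠ n in l i, P i A n) :
    ∃ m : ℕ → ℕ, StrictMono m ∧ ∀ i, P i ((Finset.range i).image m) (m i) := by
  have hex : ∀ i A, ∃ n, P i A n ∧ ∀ a ∈ A, a < n := fun i A =>
    ((hP i A).and ((Filter.eventually_all_finset A).2 fun a _ =>
      hl i (eventually_gt_atTop a))).exists
  choose f hf hf' using hex
  let A : ℕ → Finset ℕ := fun i => Nat.rec ∅ (fun i A => insert (f i A) A) i
  have hA : ∀ i, A i = (Finset.range i).image fun i => f i (A i) := by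
    intro i
    induction i with
    | zero => rfl
    | succ i ih =>
      rw [Finset.range_add_one, Finset.image_insert, ← ih]
  refine ⟨fun i => f i (A i), strictMono_nat_of_lt_succ fun i => ?_, fun i => ?_⟩
  · refine hf' (i + 1) (A (i + 1)) _ ?_
    rw [hA (i + 1)]
    exact Finset.mem_image.2 ⟨i, by simp, rfl⟩
  · rw [← hA i]
    exact hf i _

/-! ### Plegma families -/

/-- Comparison across several positions reduces to adjacent ones: the element of `s j` at position
`pos (s i) a + 1` lies above `a` and is at most `b`. -/
theorem IsPlegma.plegma {k : ℕ} {s : Fin k → Finset ℕ} (hs : IsPlegma s) : Plegma s := by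
  intro i j a ha b hb hab
  rcases hab with hab | ⟨hab, hij⟩
  · have hcard : pos (s i) a + 1 < (s j).card := (Nat.succ_le_of_lt hab).trans_lt (pos_lt_card hb)
    have h1 := hs.lt_succ i j _ (pos_lt_card ha) hcard
    rw [finElt_pos ha] at h1
    refine h1.trans_le ?_
    by_contra! h2
    have h3 := pos_lt_pos hb h2
    rw [pos_finElt hcard] at h3
    omega
  · have hcard := pos_lt_card hb
    rw [← hab] at hcard
    have h1 := hs.lt_of_lt i j hij _ (pos_lt_card ha) hcard
    rwa [finElt_pos ha, hab, finElt_pos hb] at h1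

theorem Plegma.isPlegma {k : ℕ} {s : Fin k → Finset ℕ} (hs : Plegma s)
    (hne : ∀ i, (s i).Nonempty) : IsPlegma s where
  nonempty := hne
  lt_of_lt i j hij m hi hj := hs i j _ (finElt_mem hi) _ (finElt_mem hj) (Or.inr
    ⟨by rw [pos_finElt hi, pos_finElt hj], hij⟩)
  lt_succ i j m hi hj := hs i j _ (finElt_mem hi) _ (finElt_mem hj) (Or.inl
    (by rw [pos_finElt hi, pos_finElt hj]; exact Nat.lt_succ_self m))

theorem Plegma.comp {ι κ : Type*} [LinearOrder ι] [LinearOrder κ] {s : ι → Finset ℕ}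
    (hs : Plegma s) {e : κ → ι} (he : StrictMono e) : Plegma (s ∘ e) :=
  fun i j a ha b hb hab => hs (e i) (e j) a ha b hb (hab.imp_right fun h => ⟨h.1, he h.2⟩)

/-! ### The largest initial segment in a family -/

open Classical in
/-- The largest initial segment of `t` lying in the hereditary family `R`. -/
noncomputable def trunc (R : Set (Finset ℕ)) (t : Finset ℕ) : Finset ℕ :=
  t.filter fun n => t.filter (· ≤ n) ∈ R

theorem mem_trunc {R : Set (Finset ℕ)} {t : Finset ℕ} {n : ℕ} :
    n ∈ trunc R t ↔ n ∈ t ∧ t.filter (· ≤ n) ∈ R := by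
  simp [trunc]

theorem trunc_subset (R : Set (Finset ℕ)) (t : Finset ℕ) : trunc R t ⊆ t :=
  fun _ h => (mem_trunc.1 h).1

theorem trunc_mem {R : Set (Finset ℕ)} (hR : IsRegularFamily R) (h0 : ∅ ∈ R) (t : Finset ℕ) :
    trunc R t ∈ R := by
  rcases (trunc R t).eq_empty_or_nonempty with h | h
  · rwa [h]
  · refine hR.hereditary _ (mem_trunc.1 ((trunc R t).max'_mem h)).2 _ fun a ha => ?_
    exact Finset.mem_filter.2 ⟨trunc_subset R t ha, Finset.le_max' _ _ ha⟩

theorem mem_trunc_of_le {R : Set (Finset ℕ)} (hR : IsRegularFamily R) {t : Finset ℕ} {a n : ℕ}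
    (hn : n ∈ trunc R t) (ha : a ∈ t) (han : a ≤ n) : a ∈ trunc R t := by
  refine mem_trunc.2 ⟨ha, hR.hereditary _ (mem_trunc.1 hn).2 _ fun b hb => ?_⟩
  rw [Finset.mem_filter] at hb ⊢
  exact ⟨hb.1, hb.2.trans han⟩

theorem pos_trunc {R : Set (Finset ℕ)} (hR : IsRegularFamily R) {t : Finset ℕ} {n : ℕ}
    (hn : n ∈ trunc R t) : pos (trunc R t) n = pos t n := by
  refine congrArg Finset.card (Finset.ext fun a => ?_)
  simp only [Finset.mem_filter]
  exact ⟨fun h => ⟨trunc_subset R t h.1, h.2⟩,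
    fun h => ⟨mem_trunc_of_le hR hn h.1 h.2.le, h.2⟩⟩

theorem mem_trunc_congr {R : Set (Finset ℕ)} {t t' : Finset ℕ} {n : ℕ}
    (h : ∀ a ≤ n, a ∈ t ↔ a ∈ t') : n ∈ trunc R t ↔ n ∈ trunc R t' := by
  have : t.filter (· ≤ n) = t'.filter (· ≤ n) := by
    ext a
    simp only [Finset.mem_filter]
    exact ⟨fun ha => ⟨(h a ha.2).1 ha.1, ha.2⟩, fun ha => ⟨(h a ha.2).2 ha.1, ha.2⟩⟩
  rw [mem_trunc, mem_trunc, this, h n le_rfl]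

theorem pos_image {s : Finset ℕ} {σ : ℕ → ℕ} (hσ : StrictMonoOn σ s) {a : ℕ} (ha : a ∈ s) :
    pos (s.image σ) (σ a) = pos s a := by
  have : (s.image σ).filter (· < σ a) = (s.filter (· < a)).image σ := by
    ext x
    simp only [Finset.mem_filter, Finset.mem_image]
    constructor
    · rintro ⟨⟨b, hb, rfl⟩, h⟩
      exact ⟨b, ⟨hb, (hσ.lt_iff_lt hb ha).1 h⟩, rfl⟩
    · rintro ⟨b, ⟨hb, h⟩, rfl⟩
      exact ⟨⟨b, hb, rfl⟩, hσ hb ha h⟩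
  rw [pos, this, Finset.card_image_of_injOn]
  · rfl
  · exact hσ.injOn.mono fun x hx => (Finset.mem_filter.1 hx).1

/-! ### Characteristic functions -/

theorem charFun_injective : Function.Injective charFun := by
  intro s t h
  ext n
  simpa [charFun] using congrFun h n

/-- Each output bit depends on finitely many input bits, so it is locally constant on the family. -/
theorem continuousOn_charFun_comp {A : Set (Finset ℕ)} (Ψ : Finset ℕ → Finset ℕ)
    (h : ∀ n, ∃ K : Finset ℕ, ∀ s ∈ A, ∀ s' ∈ A, (∀ k ∈ K, k ∈ s ↔ k ∈ s') →
      (n ∈ Ψ s ↔ n ∈ Ψ s')) :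
    ContinuousOn (fun c => charFun (Ψ (Function.invFun charFun c))) (charFun '' A) := by
  rw [continuousOn_pi]
  rintro n _ ⟨s, hs, rfl⟩
  obtain ⟨K, hK⟩ := h n
  refine tendsto_const_nhds.congr' ?_
  have hnear : ∀ᶠ c in 𝓝 (charFun s), ∀ k ∈ K, c k = charFun s k := by
    rw [Filter.eventually_all_finset]
    intro k _
    exact (continuous_apply k).continuousAt.eventually_mem
      ((isOpen_discrete {charFun s k}).mem_nhds rfl)
  filter_upwards [nhdsWithin_le_nhds hnear, self_mem_nhdsWithin] with c hc hcA
  obtain ⟨s', hs', rfl⟩ := hcA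
  rw [Function.leftInverse_invFun charFun_injective, Function.leftInverse_invFun charFun_injective]
  have := hK s hs s' hs' fun k hk => by
    have := hc k hk
    simp only [charFun, decide_eq_decide] at this
    exact this.symm
  simpa [charFun] using this

/-! ### Presentations of spreading models -/

section Presentation

variable {X : Type*} [NormedAddCommGroup X] [NormedSpace ℝ X] {ξ : Ordinal.{0}}

/-- The data generating `p` as a `ξ`-order spreading model; the weakly continuous extension `φ`
gives the vectors of the family. -/
structure Presentation (X : Type*) [NormedAddCommGroup X] [NormedSpace ℝ X] (ξ : Ordinal.{0})
    (p : Seminorm ℝ (ℕ →₀ ℝ)) where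
  /-- The regular family. -/
  R : Set (Finset ℕ)
  /-- The infinite set. -/
  L : Set ℕ
  /-- The weakly continuous extension. -/
  φ : (ℕ → Bool) → X
  regular : IsRegularFamily R
  order : HasOrder R ξ
  infinite : L.Infinite
  continuousOn : ContinuousOn (fun c => toWeakSpace ℝ X (φ c)) (charFun '' restrictFamily R L)
  weaklyNull : IsWeaklyNull {s | Maximal (· ∈ R) s} (fun s => φ (charFun s)) L
  generates : GeneratesSpreadingModel {s | Maximal (· ∈ R) s} (fun s => φ (charFun s)) L p

theorem exists_presentation {p : Seminorm ℝ (ℕ →₀ ℝ)} (hp : p ∈ spreadingModelSet X ξ) :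
    Nonempty (Presentation X ξ p) := by
  obtain ⟨F, L, x, ⟨R, hR, hord, rfl⟩, hL, ⟨φ, hφ, hx⟩, hnull, δ, hδ, hδ0, hgen⟩ := hp
  have hwf : WellFounded (ProperExt R) := wellFounded_properExt hord.choose
  rw [familyHat_maximal hR hwf] at hφ
  refine ⟨⟨R, L, φ, hR, hord, hL, hφ, fun f ε hε => ?_, δ, hδ, hδ0, ?_⟩⟩
  · obtain ⟨n₀, hn⟩ := hnull f ε hε
    refine ⟨n₀, fun s hs hs' => ?_⟩
    have h := hn s hs hs'
    rwa [hx s hs] at h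
  · intro l k hk hkl a ha s hs hpl hmin
    have := hgen l k hk hkl a ha s hs hpl hmin
    simpa only [hx _ (hs _)] using this

namespace Presentation

variable {p : Seminorm ℝ (ℕ →₀ ℝ)} (D : Presentation X ξ p)

/-- The regular thin family. -/
def F : Set (Finset ℕ) := {s | Maximal (· ∈ D.R) s}

/-- The regular family restricted to `L`. -/
def Q : Set (Finset ℕ) := restrictFamily D.R D.L

/-- The vectors of the family. -/
def vec (s : Finset ℕ) : X := D.φ (charFun s)

theorem wf_R : WellFounded (ProperExt D.R) := wellFounded_properExt D.order.choose

theorem wf_Q : WellFounded (ProperExt D.Q) :=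
  Subrelation.wf (fun {_ _} h => ⟨h.1.1, h.2⟩) D.wf_R

theorem empty_mem_R (hξ : 1 ≤ ξ) : ∅ ∈ D.R := by
  obtain ⟨s, hs, -⟩ := D.order.exists_nonempty hξ
  exact D.regular.hereditary s hs ∅ (Finset.empty_subset s)

theorem empty_mem_Q (hξ : 1 ≤ ξ) : ∅ ∈ D.Q := ⟨D.empty_mem_R hξ, by simp⟩

theorem hereditary_Q {s : Finset ℕ} (hs : s ∈ D.Q) {t : Finset ℕ} (h : t ⊆ s) : t ∈ D.Q :=
  ⟨D.regular.hereditary s hs.1 t h, (Finset.coe_subset.2 h).trans hs.2⟩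

theorem nonempty_of_mem_F (hξ : 1 ≤ ξ) {s : Finset ℕ} (hs : s ∈ D.F) : s.Nonempty := by
  obtain ⟨t, ht, htne⟩ := D.order.exists_nonempty hξ
  by_contra hne
  rw [Finset.not_nonempty_iff_eq_empty] at hne
  subst hne
  have := hs.2 ht (Finset.empty_subset t)
  exact htne.ne_empty (Finset.subset_empty.1 this)

theorem notMem_F_of_ssubset {s t : Finset ℕ} (hs : s ∈ D.F) (h : t ⊂ s) : t ∉ D.F :=
  fun ht => h.2 (ht.2 hs.1 h.1)

theorem eventually_insert_mem_Q {l : Filter ℕ} (hl : l ≤ atTop) (hL : D.L ∈ l) {s : Finset ℕ}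
    (hs : s ∈ D.Q) (hsF : s ∉ D.F) : ∀ᶠ n in l, insert n s ∈ D.Q := by
  filter_upwards [hl (D.regular.eventually_insert_mem hs.1 hsF), hL] with n hn hnL
  refine ⟨hn, ?_⟩
  rw [Finset.coe_insert]
  exact Set.insert_subset hnL hs.2

theorem tendsto_vec {α : Type*} {l : Filter α} {t : α → Finset ℕ} {s : Finset ℕ} (hs : s ∈ D.Q)
    (ht : ∀ᶠ n in l, t n ∈ D.Q) (h : ∀ k, ∀ᶠ n in l, (k ∈ t n ↔ k ∈ s)) (f : X →L[ℝ] ℝ) :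
    Tendsto (fun n => f (D.vec (t n))) l (𝓝 (f (D.vec s))) := by
  have hf : Continuous fun y : WeakSpace ℝ X => f ((toWeakSpace ℝ X).symm y) :=
    WeakBilin.eval_continuous (topDualPairing ℝ X).flip f
  have hc : ContinuousOn (fun c => f (D.φ c)) (charFun '' D.Q) :=
    hf.comp_continuousOn D.continuousOn
  have h1 : Tendsto (fun n => charFun (t n)) l (𝓝[charFun '' D.Q] (charFun s)) := by
    refine tendsto_nhdsWithin_iff.2 ⟨tendsto_pi_nhds.2 fun k => ?_,
      ht.mono fun n hn => Set.mem_image_of_mem _ hn⟩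
    refine tendsto_const_nhds.congr' ((h k).mono fun n hn => ?_)
    simp [charFun, hn]
  exact (hc _ (Set.mem_image_of_mem _ hs)).tendsto.comp h1

theorem tendsto_vec_insert {l : Filter ℕ} (hl : l ≤ atTop) (hL : D.L ∈ l) {s : Finset ℕ}
    (hs : s ∈ D.Q) (hsF : s ∉ D.F) (f : X →L[ℝ] ℝ) :
    Tendsto (fun n => f (D.vec (insert n s))) l (𝓝 (f (D.vec s))) := by
  refine D.tendsto_vec hs (D.eventually_insert_mem_Q hl hL hs hsF) (fun k => ?_) f
  filter_upwards [hl (eventually_gt_atTop k)] with n hn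
  simp [hn.ne]

theorem isGrowth {ι : Type*} {P : ι → Seminorm ℝ (ℕ →₀ ℝ)}
    (D : ∀ i, Presentation X ξ (P i)) {U : ι → Ultrafilter ℕ} (hU : ∀ i, (U i : Filter ℕ) ≤ atTop)
    (hL : ∀ i, (D i).L ∈ U i) : IsGrowth (fun i => (D i).Q) (fun i => (D i).F) U where
  wf i := (D i).wf_Q
  le_atTop := hU
  ext i _ hs hsF := (D i).eventually_insert_mem_Q (hU i) (hL i) hs hsF

end Presentation

theorem exists_ultrafilter_le_atTop {L : Set ℕ} (hL : L.Infinite) :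
    ∃ U : Ultrafilter ℕ, (U : Filter ℕ) ≤ atTop ∧ L ∈ U := by
  have : NeBot (atTop ⊓ 𝓟 L) :=
    Filter.frequently_mem_iff_neBot.1 (Nat.frequently_atTop_iff_infinite.2 hL)
  have h := Ultrafilter.of_le (atTop ⊓ 𝓟 L)
  exact ⟨Ultrafilter.of (atTop ⊓ 𝓟 L), h.trans inf_le_left,
    h (Filter.mem_inf_of_right (mem_principal_self L))⟩

/-- Regular thin families contain plegma tuples of any length inside any infinite set. -/
theorem exists_plegma {ι : Type*} [Fintype ι] [LinearOrder ι] {R : Set (Finset ℕ)}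
    (hR : IsRegularFamily R) (hord : HasOrder R ξ) (h0 : ∅ ∈ R) {L : Set ℕ} (hL : L.Infinite)
    (N : ℕ) : ∃ t : ι → Finset ℕ, Plegma t ∧
      (∀ i, t i ∈ restrictFamily {s | Maximal (· ∈ R) s} L) ∧ ∀ i, ∀ a ∈ t i, N ≤ a := by
  obtain ⟨U, hU, hUL⟩ := exists_ultrafilter_le_atTop hL
  have hg : IsGrowth (fun _ : ι => restrictFamily R L)
      (fun _ => {s : Finset ℕ | Maximal (· ∈ R) s}) (fun _ => U) :=
    { wf := fun _ => Subrelation.wf (fun {_ _} h => ⟨h.1.1, h.2⟩)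
        (wellFounded_properExt hord.choose)
      le_atTop := fun _ => hU
      ext := fun _ s hs hs' => by
        filter_upwards [hU (hR.eventually_insert_mem hs.1 hs'), hUL] with n hn hnL
        refine ⟨hn, ?_⟩
        rw [Finset.coe_insert]
        exact Set.insert_subset hnL hs.2 }
  obtain ⟨t, h1, h2, -, h3, h4⟩ :=
    (eventually_leaf_empty hg (fun _ => ⟨h0, by simp⟩) N).exists
  exact ⟨t, h1, fun i => ⟨h4 i, (h3 i).2⟩, h2⟩

namespace Presentation

variable {p : Seminorm ℝ (ℕ →₀ ℝ)} (D : Presentation X ξ p)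

/-- Maximal sets with minimum tending to infinity converge to ∅; their vectors tend weakly to the
value at ∅ by continuity and to 0 by weak nullness. -/
theorem vec_empty (hξ : 1 ≤ ξ) : D.vec ∅ = 0 := by
  have hex : ∀ N : ℕ, ∃ t ∈ restrictFamily D.F D.L, ∀ a ∈ t, N ≤ a := fun N => by
    obtain ⟨t, -, h1, h2⟩ := exists_plegma (ι := Unit) D.regular D.order (D.empty_mem_R hξ)
      D.infinite N
    exact ⟨t (), h1 (), h2 ()⟩
  choose t ht htN using hex
  refine (SeparatingDual.eq_zero_iff_forall_dual_eq_zero (R := ℝ) _).2 fun f => ?_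
  refine tendsto_nhds_unique (D.tendsto_vec (l := atTop) (t := t) (D.empty_mem_Q hξ)
    (Eventually.of_forall fun n => ⟨(ht n).1.1, (ht n).2⟩) (fun k => ?_) f) ?_
  · filter_upwards [eventually_gt_atTop k] with n hn
    simp only [Finset.notMem_empty, iff_false]
    exact fun hk => (htN n k hk).not_gt hn
  · refine Metric.tendsto_atTop.2 fun ε hε => ?_
    obtain ⟨n₀, hn₀⟩ := D.weaklyNull f ε hε
    refine ⟨n₀, fun n hn => ?_⟩
    rw [Real.dist_eq, sub_zero]
    exact hn₀ _ (ht n) fun a ha => hn.le.trans (htN n a ha)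

/-- The spreading model estimate for single sets at level `l = 0` applies to every index, as its
minimum is at least that of `L`. -/
theorem exists_bound (hξ : 1 ≤ ξ) : ∃ C, ∀ s ∈ D.Q, s ∈ D.F → ‖D.vec s‖ ≤ C := by
  obtain ⟨δ, -, -, hgen⟩ := D.generates
  refine ⟨p (∑ j : Fin 1, Finsupp.single (j : ℕ) 1) + δ 0, fun s hs hsF => ?_⟩
  have hne := D.nonempty_of_mem_F hξ hsF
  have h := hgen 0 1 one_pos le_rfl (fun _ => 1) (fun _ => by simp) (fun _ => s)
    (fun _ => ⟨hsF, hs.2⟩) (Plegma.isPlegma ?_ fun _ => hne) ?_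
  · rw [abs_le] at h
    simp only [Finset.univ_unique, Finset.sum_singleton, one_smul] at h ⊢
    have := h.2
    change ‖D.vec s‖ - _ ≤ _ at this
    linarith
  · intro i j a ha b hb hab
    rcases hab with hab | ⟨-, hab⟩
    · exact lt_of_pos_lt hab
    · exact absurd (Subsingleton.elim i j) hab.ne
  · have hmem : finElt s 0 ∈ D.L := hs.2 (finElt_mem (Finset.card_pos.2 hne))
    rw [infElt, Nat.nth_zero]
    exact Nat.sInf_le hmem

/-- The norms of the combinations along plegma tuples far out approximate the seminorm. -/
theorem exists_approx (hξ : 1 ≤ ξ) {k : ℕ} (hk : 0 < k) {ε : ℝ} (hε : 0 < ε) :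
    ∃ N : ℕ, ∀ s : Fin k → Finset ℕ, Plegma s → (∀ j, s j ∈ D.Q) → (∀ j, s j ∈ D.F) →
      (∀ j, ∀ n ∈ s j, N ≤ n) → ∀ a : Fin k → ℝ, (∀ j, |a j| ≤ 1) →
        |‖∑ j, a j • D.vec (s j)‖ - p (∑ j : Fin k, Finsupp.single (j : ℕ) (a j))| ≤ ε := by
  obtain ⟨δ, -, hδ, hgen⟩ := D.generates
  obtain ⟨l, hl, hkl⟩ := ((hδ.eventually (gt_mem_nhds hε)).and (eventually_ge_atTop k)).exists
  refine ⟨infElt D.L l, fun s hs hsQ hsF hsN a ha => ?_⟩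
  have hne : ∀ j, (s j).Nonempty := fun j => D.nonempty_of_mem_F hξ (hsF j)
  exact (hgen l k hk (by omega) a (fun j => abs_le.1 (ha j)) s (fun j => ⟨hsF j, (hsQ j).2⟩)
    (hs.isPlegma hne) (hsN _ _ (finElt_mem (Finset.card_pos.2 (hne _))))).trans hl.le

end Presentation

end Presentation

/-! ### Interlaced plegma families of two presentations -/

section Joint

variable {X : Type*} [NormedAddCommGroup X] [NormedSpace ℝ X] {ξ : Ordinal.{0}}
  {P : Bool → Seminorm ℝ (ℕ →₀ ℝ)} (D : ∀ b, Presentation X ξ (P b)) {U : Bool → Ultrafilter ℕ}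

/-- The kind of a coordinate of an interlaced tuple. -/
def kind {k : ℕ} (q : Fin k ×ₗ Bool) : Bool := (ofLex q).2

/-- The coefficients `a`, repeated for both kinds. -/
def repeated {k : ℕ} (a : Fin k → ℝ) (q : Fin k ×ₗ Bool) : ℝ := a (ofLex q).1

theorem sum_lex {M : Type*} [AddCommMonoid M] {k : ℕ} (f : Fin k ×ₗ Bool → M) :
    ∑ q, f q = ∑ b, ∑ j, f (toLex (j, b)) := by
  rw [Finset.sum_comm]
  exact (Fintype.sum_equiv ofLex f (fun q => f (toLex q)) fun _ => rfl).trans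
    (Fintype.sum_prod_type _)

theorem strictMono_toLex (k : ℕ) (b : Bool) :
    StrictMono fun j : Fin k => (toLex (j, b) : Fin k ×ₗ Bool) :=
  fun _ _ h => Prod.Lex.toLex_lt_toLex.2 (Or.inl h)

theorem isGrowth_interlaced (k : ℕ) (hU : ∀ b, (U b : Filter ℕ) ≤ atTop)
    (hL : ∀ b, (D b).L ∈ U b) :
    IsGrowth (fun q : Fin k ×ₗ Bool => (D (kind q)).Q) (fun q => (D (kind q)).F)
      (fun q => U (kind q)) :=
  Presentation.isGrowth (fun q => D (kind q)) (fun q => hU (kind q)) fun q => hL (kind q)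

theorem exists_common_bound (hξ : 1 ≤ ξ) (k : ℕ) : ∃ C, ∀ q : Fin k ×ₗ Bool,
    ∀ s ∈ (D (kind q)).Q, s ∈ (D (kind q)).F → ‖(D (kind q)).vec s‖ ≤ C := by
  choose C hC using fun b => (D b).exists_bound hξ
  refine ⟨max (C false) (C true), fun q s hs hsF => (hC _ s hs hsF).trans ?_⟩
  cases kind q
  · exact le_max_left _ _
  · exact le_max_right _ _

theorem le_leafValue_interlaced (hξ : 1 ≤ ξ) {k : ℕ} (hk : 0 < k)
    (h : IsGrowth (fun q : Fin k ×ₗ Bool => (D (kind q)).Q) (fun q => (D (kind q)).F)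
      (fun q => U (kind q))) (hL : ∀ b, (D b).L ∈ U b) (b : Bool) {a : Fin k → ℝ}
    (ha : ∀ j, |a j| ≤ 1) :
    P b (∑ j : Fin k, Finsupp.single (j : ℕ) (a j)) ≤
      leafValue h (fun q => (D (kind q)).vec) (fun _ => ∅) (repeated a) := by
  obtain ⟨C, hC⟩ := exists_common_bound D hξ k
  set v := leafValue h (fun q => (D (kind q)).vec) (fun _ => ∅) (repeated a)
  have h0 : ∀ q : Fin k ×ₗ Bool, ∅ ∈ (D (kind q)).Q := fun q => (D (kind q)).empty_mem_Q hξ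
  have hlim : LimLE (leaf h (fun _ => ∅) : Filter (Fin k ×ₗ Bool → Finset ℕ))
      (fun t => ‖∑ q, repeated a q • (D (kind q)).vec (t q)‖) v := by
    intro r hr
    filter_upwards [leafValue_spec h hC h0 (r - v) (sub_pos.2 hr)] with t ht
    have := (abs_le.1 (ht (repeated a) fun q => ha _)).2
    simp only [v] at this ⊢
    linarith
  -- Every set counts as terminal for the kinds other than `b`, so those coordinates stay at ∅ and
  -- contribute zero vectors.
  set T' : Fin k ×ₗ Bool → Set (Finset ℕ) :=
    fun q => if kind q = b then (D (kind q)).F else Set.univ with hT'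
  have hTT' : ∀ q, T' q = (D (kind q)).F ∨ T' q = Set.univ := fun q => by
    simp only [hT']
    split_ifs <;> simp
  have h' : IsGrowth (fun q : Fin k ×ₗ Bool => (D (kind q)).Q) T' (fun q => U (kind q)) :=
    h.of_subset fun q => (hTT' q).elim (fun e => e ▸ subset_rfl) fun e => e ▸ Set.subset_univ _
  have hfreeze := LimLE.freeze h h' hTT' (fun q s => repeated a q • (D (kind q)).vec s) ?_ h0 v hlim
  · refine le_of_forall_pos_le_add fun ε hε => ?_
    obtain ⟨N, hN⟩ := (D b).exists_approx hξ hk (half_pos hε)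
    obtain ⟨t, ht1, ht2, ht3, ht4, ht5, ht6⟩ :=
      ((hfreeze (v + ε / 2) (by linarith)).and (eventually_leaf_empty h' h0 N)).exists
    have hker : ∀ j, ∀ b', b' ≠ b → t (toLex (j, b')) = ∅ := by
      intro j b' hb
      refine ht4 _ ?_
      have : kind (toLex (j, b')) ≠ b := hb
      simp [hT', this]
    have hsum : ∑ q, repeated a q • (D (kind q)).vec (t q) =
        ∑ j, a j • (D b).vec (t (toLex (j, b))) := by
      rw [sum_lex, Fintype.sum_eq_single b]
      · rfl
      · intro b' hb
        refine Finset.sum_eq_zero fun j _ => ?_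
        rw [hker j b' hb, (D _).vec_empty hξ, smul_zero]
    have hF : ∀ j, t (toLex (j, b)) ∈ (D b).F := fun j => by
      have e : T' (toLex (j, b)) = (D b).F := if_pos rfl
      exact e ▸ ht6 (toLex (j, b))
    have := hN (fun j => t (toLex (j, b))) (ht2.comp (strictMono_toLex k b))
      (fun j => ht5 (toLex (j, b))) hF (fun j n hn => ht3 _ n hn) a ha
    change ‖∑ q, repeated a q • (D (kind q)).vec (t q)‖ ≤ _ at ht1
    rw [hsum] at ht1
    rw [abs_le] at this
    linarith [this.1]
  · intro q _ s hs hsF f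
    simp only [map_smul]
    exact ((D (kind q)).tendsto_vec_insert (h.le_atTop q) (hL (kind q)) hs hsF f).const_smul _

theorem leafValue_interlaced_le (hξ : 1 ≤ ξ) {k : ℕ} (hk : 0 < k)
    (h : IsGrowth (fun q : Fin k ×ₗ Bool => (D (kind q)).Q) (fun q => (D (kind q)).F)
      (fun q => U (kind q))) {a : Fin k → ℝ} (ha : ∀ j, |a j| ≤ 1) :
    leafValue h (fun q => (D (kind q)).vec) (fun _ => ∅) (repeated a) ≤
      ∑ b, P b (∑ j : Fin k, Finsupp.single (j : ℕ) (a j)) := by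
  obtain ⟨C, hC⟩ := exists_common_bound D hξ k
  have h0 : ∀ q : Fin k ×ₗ Bool, ∅ ∈ (D (kind q)).Q := fun q => (D (kind q)).empty_mem_Q hξ
  refine le_of_forall_pos_le_add fun ε hε => ?_
  choose N hN using fun b => (D b).exists_approx hξ hk (ε := ε / 3) (by positivity)
  obtain ⟨t, ht1, ht2, ht3, -, ht5, ht6⟩ := ((leafValue_spec h hC h0 (ε / 3) (by positivity)).and
    (eventually_leaf_empty h h0 (max (N false) (N true)))).exists
  have h1 := (abs_le.1 (ht1 (repeated a) fun q => ha _)).1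
  have h2 : ∀ b, ‖∑ j, a j • (D b).vec (t (toLex (j, b)))‖ ≤
      P b (∑ j : Fin k, Finsupp.single (j : ℕ) (a j)) + ε / 3 := by
    intro b
    have := hN b (fun j => t (toLex (j, b))) (ht2.comp (strictMono_toLex k b))
      (fun j => ht5 (toLex (j, b))) (fun j => ht6 (toLex (j, b))) (fun j n hn => ?_) a ha
    · linarith [(abs_le.1 this).2]
    · refine le_trans ?_ (ht3 _ n hn)
      cases b
      · exact le_max_left _ _
      · exact le_max_right _ _
  have h3 : ‖∑ q, repeated a q • (D (kind q)).vec (t q)‖ ≤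
      ∑ b, ‖∑ j, a j • (D b).vec (t (toLex (j, b)))‖ := by
    rw [sum_lex]
    exact norm_sum_le _ _
  have h4 := Finset.sum_le_sum fun b (_ : b ∈ Finset.univ) => h2 b
  simp only [Fintype.sum_bool] at h3 h4 ⊢
  linarith

/-- A sequence along which the interlaced plegma families of the two presentations have
asymptotically determined norms. -/
theorem exists_interlacing (hξ : 1 ≤ ξ) : ∃ m : ℕ → ℕ, StrictMono m ∧
    (∀ i, m i ∈ (D i.bodd).L) ∧
    (∀ i, ∀ s ⊆ (Finset.range i).image m, s ∈ (D i.bodd).Q → s ∉ (D i.bodd).F →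
      insert (m i) s ∈ (D i.bodd).Q) ∧
    ∀ k, 0 < k → ∃ v : (Fin k → ℝ) → ℝ,
      (∀ i, k ≤ i + 1 → ∀ t : Fin k ×ₗ Bool → Finset ℕ, Plegma t → (∀ q, t q ∈ (D (kind q)).Q) →
        (∀ q, t q ∈ (D (kind q)).F) →
        (∀ q, ∀ n ∈ t q, ∃ i' ≥ i, i'.bodd = kind q ∧ n = m i') →
        ∀ a : Fin k → ℝ, (∀ j, |a j| ≤ 1) →
          |‖∑ b, ∑ j, a j • (D b).vec (t (toLex (j, b)))‖ - v a| ≤ 2 * (1 / 2) ^ i) ∧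
      ∀ a : Fin k → ℝ, (∀ j, |a j| ≤ 1) →
        (∀ b, P b (∑ j : Fin k, Finsupp.single (j : ℕ) (a j)) ≤ v a) ∧
          v a ≤ ∑ b, P b (∑ j : Fin k, Finsupp.single (j : ℕ) (a j)) := by
  choose U hU hL using fun b => exists_ultrafilter_le_atTop (D b).infinite
  have hg := fun k => isGrowth_interlaced D k hU hL
  -- The parity of `i` decides which ultrafilter supplies `m i`. Only lengths `k ≤ i + 1` and tuples
  -- of subsets of the earlier values are tested, so stage `i` imposes finitely many conditions.
  have hsel := exists_strictMono_selection (l := fun i => (U i.bodd : Filter ℕ))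
    (fun i => hU i.bodd) (P := fun i A n => n ∈ (D i.bodd).L ∧
      (∀ s ∈ A.powerset, s ∈ (D i.bodd).Q → s ∉ (D i.bodd).F → insert n s ∈ (D i.bodd).Q) ∧
      ∀ k ∈ Finset.range (i + 2), ∀ ν ∈ Fintype.piFinset fun _ : Fin k ×ₗ Bool => A.powerset,
        (∀ q, ν q ∈ (D (kind q)).Q) → ∀ j, i.bodd = kind j →
        IsNext (fun q => (D (kind q)).F) ν j → ∀ c : Fin k ×ₗ Bool → ℝ, (∀ q, |c q| ≤ 1) →
          |leafValue (hg k) (fun q => (D (kind q)).vec) (child ν j n) c -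
            leafValue (hg k) (fun q => (D (kind q)).vec) ν c| ≤ (1 / 2) ^ i) ?_
  · obtain ⟨m, hm, hP⟩ := hsel
    refine ⟨m, hm, fun i => (hP i).1, fun i s hs => (hP i).2.1 s (Finset.mem_powerset.2 hs),
      fun k hk => ⟨fun a => leafValue (hg k) (fun q => (D (kind q)).vec) (fun _ => ∅) (repeated a),
        ?_, fun a ha => ⟨fun b => le_leafValue_interlaced D hξ hk (hg k) hL b ha,
          leafValue_interlaced_le D hξ hk (hg k) ha⟩⟩⟩
    intro i hki t ht htQ htF htm a ha
    obtain ⟨C, hC⟩ := exists_common_bound D hξ k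
    have := abs_norm_sub_leafValue_le (hg k) hC (fun q s hs t hts => (D _).hereditary_Q hs hts)
      (fun q s hs t hts => (D _).notMem_F_of_ssubset hs hts) hm
      (J := fun i q => i.bodd = kind q) (l := i) ?_ ht htQ htF htm (c := repeated a) fun q => ha _
    · rw [sum_lex] at this
      exact this
    · intro i' hi' ν hν hνm j hj hnext c hc
      exact (hP i').2.2 k (Finset.mem_range.2 (by omega)) ν
        (Fintype.mem_piFinset.2 fun q => Finset.mem_powerset.2 (hνm q)) hν j hj hnext c hc
  · intro i A
    refine Eventually.and (hL i.bodd) (Eventually.and ?_ ?_)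
    · rw [Filter.eventually_all_finset]
      intro s _
      by_cases hs : s ∈ (D i.bodd).Q ∧ s ∉ (D i.bodd).F
      · filter_upwards [(D i.bodd).eventually_insert_mem_Q (hU _) (hL _) hs.1 hs.2] with n hn _ _
        exact hn
      · exact Eventually.of_forall fun n h1 h2 => absurd ⟨h1, h2⟩ hs
    · rw [Filter.eventually_all_finset]
      intro k _
      rw [Filter.eventually_all_finset]
      intro ν _
      by_cases hν : ∀ q, ν q ∈ (D (kind q)).Q
      · have : ∀ j, ∀ᶠ n in (U i.bodd : Filter ℕ), i.bodd = kind j →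
            IsNext (fun q => (D (kind q)).F) ν j → ∀ c : Fin k ×ₗ Bool → ℝ, (∀ q, |c q| ≤ 1) →
            |leafValue (hg k) (fun q => (D (kind q)).vec) (child ν j n) c -
              leafValue (hg k) (fun q => (D (kind q)).vec) ν c| ≤ (1 / 2) ^ i := by
          intro j
          by_cases hj : i.bodd = kind j ∧ IsNext (fun q => (D (kind q)).F) ν j
          · obtain ⟨C, hC⟩ := exists_common_bound D hξ k
            have := eventually_leafValue_child (hg k) hC hν hj.2 (ε := (1 / 2) ^ i) (by positivity)
            rw [← hj.1] at this
            filter_upwards [this] with n hn _ _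
            exact hn
          · exact Eventually.of_forall fun n h1 h2 => absurd ⟨h1, h2⟩ hj
        filter_upwards [eventually_all.2 this] with n hn _
        exact hn
      · exact Eventually.of_forall fun n h => absurd h hν

end Joint

/-! ### The joined family -/

section Join

variable {X : Type*} [NormedAddCommGroup X] [NormedSpace ℝ X] {ξ : Ordinal.{0}}

/-- The odd-indexed values of `m`. -/
def oddRange (m : ℕ → ℕ) : Set ℕ := Set.range fun i => m (Nat.bit true i)

/-- The map sending `m (2 i + 1)` to `m (2 i + b)`. -/
noncomputable def shift (m : ℕ → ℕ) (b : Bool) (n : ℕ) : ℕ :=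
  m (Nat.bit b (Function.invFun (fun i => m (Nat.bit true i)) n))

theorem bit_true_strictMono : StrictMono (Nat.bit true) := fun i j h => by
  simp only [Nat.bit_val]
  omega

theorem shift_apply {m : ℕ → ℕ} (hm : StrictMono m) (b : Bool) (i : ℕ) :
    shift m b (m (Nat.bit true i)) = m (Nat.bit b i) := by
  have hinj : Function.Injective fun i => m (Nat.bit true i) :=
    (hm.comp bit_true_strictMono).injective
  exact congrArg (fun j => m (Nat.bit b j)) (Function.leftInverse_invFun hinj i)

theorem shift_le {m : ℕ → ℕ} (hm : StrictMono m) (b : Bool) {n : ℕ} (hn : n ∈ oddRange m) :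
    shift m b n ≤ n := by
  obtain ⟨i, rfl⟩ := hn
  rw [shift_apply hm]
  refine hm.monotone ?_
  cases b <;> simp [Nat.bit_val]

theorem shift_lt_shift {m : ℕ → ℕ} (hm : StrictMono m) (b b' : Bool) {n n' : ℕ}
    (hn : n ∈ oddRange m) (hn' : n' ∈ oddRange m) (h : n < n') : shift m b n < shift m b' n' := by
  obtain ⟨i, rfl⟩ := hn
  obtain ⟨i', rfl⟩ := hn'
  have hi : i < i' := bit_true_strictMono.lt_iff_lt.1 (hm.lt_iff_lt.1 h)
  rw [shift_apply hm, shift_apply hm]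
  refine hm ?_
  cases b <;> cases b' <;> simp only [Nat.bit_val, Bool.toNat_true, Bool.toNat_false] <;> omega

theorem strictMonoOn_shift {m : ℕ → ℕ} (hm : StrictMono m) (b : Bool) :
    StrictMonoOn (shift m b) (oddRange m) :=
  fun _ hn _ hn' h => shift_lt_shift hm b b hn hn' h

theorem shift_false_lt_shift_true {m : ℕ → ℕ} (hm : StrictMono m) {n : ℕ} (hn : n ∈ oddRange m) :
    shift m false n < shift m true n := by
  obtain ⟨i, rfl⟩ := hn
  rw [shift_apply hm, shift_apply hm]
  refine hm ?_
  simp [Nat.bit_val]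

/-- The largest initial segment in `R` of the shift of `s`. -/
noncomputable def shiftTrunc (m : ℕ → ℕ) (b : Bool) (R : Set (Finset ℕ)) (s : Finset ℕ) :
    Finset ℕ :=
  trunc R (s.image (shift m b))

theorem exists_of_mem_shiftTrunc {m : ℕ → ℕ} (hm : StrictMono m) {b : Bool}
    {R : Set (Finset ℕ)} (hR : IsRegularFamily R) {s : Finset ℕ} (hs : (s : Set ℕ) ⊆ oddRange m)
    {n : ℕ} (hn : n ∈ shiftTrunc m b R s) :
    ∃ n' ∈ s, n = shift m b n' ∧ pos (shiftTrunc m b R s) n = pos s n' := by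
  obtain ⟨n', hn', rfl⟩ := Finset.mem_image.1 (trunc_subset _ _ hn)
  exact ⟨n', hn', rfl, (pos_trunc hR hn).trans (pos_image ((strictMonoOn_shift hm b).mono hs) hn')⟩

/-- Shifts move points only within disjoint consecutive blocks {m(2i), m(2i+1)}, so distinct points
keep their order; the two shifts of one point are ordered by kind. -/
theorem Plegma.shiftTrunc {m : ℕ → ℕ} (hm : StrictMono m) {R : Bool → Set (Finset ℕ)}
    (hR : ∀ b, IsRegularFamily (R b)) {k : ℕ} {s : Fin k → Finset ℕ} (hs : Plegma s)
    (hsm : ∀ j, (s j : Set ℕ) ⊆ oddRange m) :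
    Plegma fun q : Fin k ×ₗ Bool => shiftTrunc m (kind q) (R (kind q)) (s (ofLex q).1) := by
  intro q q' x hx y hy hxy
  obtain ⟨x', hx', rfl, hpx⟩ := exists_of_mem_shiftTrunc hm (hR _) (hsm _) hx
  obtain ⟨y', hy', rfl, hpy⟩ := exists_of_mem_shiftTrunc hm (hR _) (hsm _) hy
  rw [hpx, hpy] at hxy
  rcases hxy with hxy | ⟨hxy, hqq⟩
  · exact shift_lt_shift hm _ _ (hsm _ hx') (hsm _ hy') (hs _ _ x' hx' y' hy' (Or.inl hxy))
  · rcases Prod.Lex.lt_iff.1 hqq with h | ⟨h, h'⟩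
    · exact shift_lt_shift hm _ _ (hsm _ hx') (hsm _ hy')
        (hs _ _ x' hx' y' hy' (Or.inr ⟨hxy, h⟩))
    · rw [← h] at hxy hy'
      have e := eq_of_pos_eq hx' hy' hxy
      subst e
      obtain ⟨h1, h2⟩ : kind q = false ∧ kind q' = true := Bool.lt_iff.1 h'
      rw [h1, h2]
      exact shift_false_lt_shift_true hm (hsm _ hx')

/-- A nonmaximal truncation could be extended in `R` by any later m(2i+b). If part of the shift was
cut off, its first point could thus have been kept. If nothing was cut off, spreading back along
shift ≤ id would extend `s` in `S`. -/
theorem shiftTrunc_mem_maximal {m : ℕ → ℕ} (hm : StrictMono m) {b : Bool}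
    {R S : Set (Finset ℕ)} (hR : IsRegularFamily R) (h0 : ∅ ∈ R) (hRS : R ⊆ S)
    (hsel : ∀ i, i.bodd = b → ∀ s ⊆ (Finset.range i).image m,
      (∀ a ∈ s, ∃ i', i'.bodd = b ∧ a = m i') → s ∈ R → ¬ Maximal (· ∈ R) s → insert (m i) s ∈ R)
    {s : Finset ℕ} (hs : Maximal (· ∈ S) s) (hsm : (s : Set ℕ) ⊆ oddRange m) :
    Maximal (· ∈ R) (shiftTrunc m b R s) := by
  by_contra hmax
  set t := s.image (shift m b) with ht
  set u := shiftTrunc m b R s with hu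
  have hut : u ⊆ t := trunc_subset _ _
  have huR : u ∈ R := trunc_mem hR h0 _
  have hum : ∀ a ∈ u, ∃ i', i'.bodd = b ∧ a = m i' := by
    intro a ha
    obtain ⟨n, hn, rfl⟩ := Finset.mem_image.1 (hut ha)
    obtain ⟨i, rfl⟩ := hsm hn
    exact ⟨Nat.bit b i, Nat.bodd_bit b i, shift_apply hm b i⟩
  have key : ∀ i, (∀ a ∈ u, a < m (Nat.bit b i)) → insert (m (Nat.bit b i)) u ∈ R := by
    intro i hi
    refine hsel _ (Nat.bodd_bit b i) u (fun a ha => ?_) hum huR hmax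
    obtain ⟨i', -, rfl⟩ := hum a ha
    exact Finset.mem_image_of_mem _ (Finset.mem_range.2 (hm.lt_iff_lt.1 (hi _ ha)))
  rcases eq_or_ssubset_of_subset hut with hut' | hut'
  · obtain ⟨i, hi⟩ : ∃ i, ∀ a ∈ s, a < m (Nat.bit true i) := by
      refine ⟨s.sup id + 1, fun a ha => ?_⟩
      have h1 : a ≤ s.sup id := Finset.le_sup (f := id) ha
      exact (Nat.lt_succ_of_le h1).trans_le ((hm.comp bit_true_strictMono).id_le _)
    have hins : ((insert (m (Nat.bit true i)) s : Finset ℕ) : Set ℕ) ⊆ oddRange m := by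
      rw [Finset.coe_insert]
      exact Set.insert_subset ⟨i, rfl⟩ hsm
    have h1 := key i fun a ha => by
      obtain ⟨n, hn, rfl⟩ := Finset.mem_image.1 (hut ha)
      rw [← shift_apply hm]
      exact shift_lt_shift hm b b (hsm hn) ⟨i, rfl⟩ (hi n hn)
    rw [hut', ht, ← shift_apply hm, ← Finset.image_insert] at h1
    have h2 := hR.mem_of_image (fun n hn => shift_le hm b (hins hn))
      ((strictMonoOn_shift hm b).injOn.mono hins) h1
    have h3 := hs.2 (hRS h2) (Finset.subset_insert _ _) (Finset.mem_insert_self _ _)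
    exact (hi _ h3).false
  · have hne : (t \ u).Nonempty := Finset.sdiff_nonempty.2 hut'.2
    set n := (t \ u).min' hne with hndef
    obtain ⟨hnt, hnu⟩ := Finset.mem_sdiff.1 (Finset.min'_mem _ hne)
    rw [← hndef] at hnt hnu
    obtain ⟨i, hi⟩ : ∃ i, n = m (Nat.bit b i) := by
      obtain ⟨n', hn', h⟩ := Finset.mem_image.1 hnt
      obtain ⟨i, rfl⟩ := hsm hn'
      exact ⟨i, by rw [← h, shift_apply hm]⟩
    have hlt : ∀ a ∈ u, a < n := by
      intro a ha
      by_contra! hna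
      exact hnu (mem_trunc_of_le hR ha hnt hna)
    have h1 := key i (hi ▸ hlt)
    rw [← hi] at h1
    refine hnu (mem_trunc.2 ⟨hnt, hR.hereditary _ h1 _ fun a ha => ?_⟩)
    obtain ⟨hat, han⟩ := Finset.mem_filter.1 ha
    by_contra hau
    rw [Finset.mem_insert, not_or] at hau
    exact hau.1 (le_antisymm han (Finset.min'_le _ _ (Finset.mem_sdiff.2 ⟨hat, hau.2⟩)))

theorem continuousOn_shiftTrunc {m : ℕ → ℕ} (hm : StrictMono m) (b : Bool)
    (R S : Set (Finset ℕ)) :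
    ContinuousOn (fun c => charFun (shiftTrunc m b R (Function.invFun charFun c)))
      (charFun '' restrictFamily S (oddRange m)) := by
  refine continuousOn_charFun_comp _ fun n => ?_
  -- A shifted point m(2i+b) ≤ n forces i ≤ n, so these finitely many points of `s` decide the
  -- truncation up to `n`.
  refine ⟨(Finset.range (n + 1)).image fun i => m (Nat.bit true i), fun s hs s' hs' h => ?_⟩
  refine mem_trunc_congr fun a ha => ?_
  have aux : ∀ {s s' : Finset ℕ}, (s : Set ℕ) ⊆ oddRange m →
      (∀ k ∈ (Finset.range (n + 1)).image fun i => m (Nat.bit true i), k ∈ s → k ∈ s') →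
      a ∈ s.image (shift m b) → a ∈ s'.image (shift m b) := by
    intro s s' hs h has
    obtain ⟨k, hk, rfl⟩ := Finset.mem_image.1 has
    refine Finset.mem_image_of_mem _ (h k ?_ hk)
    obtain ⟨i, rfl⟩ := hs hk
    rw [shift_apply hm] at ha
    refine Finset.mem_image.2 ⟨i, Finset.mem_range.2 ?_, rfl⟩
    have h1 : Nat.bit b i ≤ m (Nat.bit b i) := hm.id_le _
    have h2 : i ≤ Nat.bit b i := by
      rw [Nat.bit_val]
      omega
    omega
  exact ⟨aux hs.2 fun k hk => (h k hk).1, aux hs'.2 fun k hk => (h k hk).2⟩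

theorem infElt_oddRange {m : ℕ → ℕ} (hm : StrictMono m) (l : ℕ) :
    infElt (oddRange m) l = m (Nat.bit true l) := by
  have hmono : StrictMono fun i => m (Nat.bit true i) := hm.comp bit_true_strictMono
  have h := Nat.nth_comp_of_strictMono (p := (· ∈ oddRange m)) (n := l) hmono
    (fun k hk => hk) fun hf => absurd hf (Set.infinite_range_of_injective hmono.injective)
  have h2 : ∀ i, m (Nat.bit true i) ∈ oddRange m := fun i => ⟨i, rfl⟩
  simp only [h2, Nat.nth_true] at h
  exact h.symm

/-! ### Reduction of seminorms to coefficients in [-1, 1] -/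

theorem exists_box_scaling (a : ℕ →₀ ℝ) : ∃ r : ℝ, 0 < r ∧ ∀ j, |(r⁻¹ • a) j| ≤ 1 := by
  have hpos : 0 < ∑ j ∈ a.support, |a j| + 1 :=
    add_pos_of_nonneg_of_pos (Finset.sum_nonneg fun j _ => abs_nonneg _) one_pos
  refine ⟨_, hpos, fun j => ?_⟩
  rw [Finsupp.smul_apply, smul_eq_mul, abs_mul, abs_inv, abs_of_pos hpos, inv_mul_le_iff₀ hpos,
    mul_one]
  by_cases hj : j ∈ a.support
  · have := Finset.single_le_sum (f := fun j => |a j|) (fun i _ => abs_nonneg _) hj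
    exact this.trans (by simp)
  · rw [Finsupp.notMem_support_iff.1 hj, abs_zero]
    exact hpos.le

theorem exists_eq_sum_single (a : ℕ →₀ ℝ) :
    ∃ k, 0 < k ∧ a = ∑ j : Fin k, Finsupp.single (j : ℕ) (a j) := by
  refine ⟨a.support.sup id + 1, Nat.succ_pos _, ?_⟩
  rw [Fin.sum_univ_eq_sum_range (fun j => Finsupp.single j (a j))]
  conv_lhs => rw [← Finsupp.sum_single a]
  refine Finsupp.sum_of_support_subset _ (fun j hj => ?_) _ fun i _ => by simp
  exact Finset.mem_range.2 (Nat.lt_succ_of_le (Finset.le_sup (f := id) hj))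

/-- Seminorms determined by asymptotic values on bounded coefficients. -/
theorem exists_seminorm_of_tendsto {T : ℕ → (ℕ →₀ ℝ) →ₗ[ℝ] X} {v : ∀ k, (Fin k → ℝ) → ℝ}
    (h : ∀ k, 0 < k → ∀ a : Fin k → ℝ, (∀ j, |a j| ≤ 1) →
      Tendsto (fun l => ‖T l (∑ j : Fin k, Finsupp.single (j : ℕ) (a j))‖) atTop (𝓝 (v k a))) :
    ∃ p : Seminorm ℝ (ℕ →₀ ℝ), ∀ a, Tendsto (fun l => ‖T l a‖) atTop (𝓝 (p a)) := by
  have hlim : ∀ a, ∃ x, Tendsto (fun l => ‖T l a‖) atTop (𝓝 x) := by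
    intro a
    obtain ⟨r, hr, hra⟩ := exists_box_scaling a
    obtain ⟨k, hk, hsum⟩ := exists_eq_sum_single (r⁻¹ • a)
    have h1 := h k hk (fun j => (r⁻¹ • a) j) fun j => hra j
    rw [← hsum] at h1
    refine ⟨r * v k fun j => (r⁻¹ • a) j, (h1.const_mul r).congr fun l => ?_⟩
    rw [map_smul, norm_smul, norm_inv, Real.norm_of_nonneg hr.le, mul_inv_cancel_left₀ hr.ne']
  choose p hp using hlim
  refine ⟨Seminorm.of p (fun a b => ?_) (fun r a => ?_), hp⟩
  · refine le_of_tendsto_of_tendsto' (hp (a + b)) ((hp a).add (hp b)) fun l => ?_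
    rw [map_add]
    exact norm_add_le _ _
  · refine tendsto_nhds_unique (hp (r • a)) (((hp a).const_mul ‖r‖).congr fun l => ?_)
    rw [map_smul, norm_smul]

theorem seminorm_le_of_box {p q : Seminorm ℝ (ℕ →₀ ℝ)}
    (h : ∀ k, 0 < k → ∀ a : Fin k → ℝ, (∀ j, |a j| ≤ 1) →
      p (∑ j : Fin k, Finsupp.single (j : ℕ) (a j)) ≤
        q (∑ j : Fin k, Finsupp.single (j : ℕ) (a j))) (a : ℕ →₀ ℝ) : p a ≤ q a := by
  obtain ⟨r, hr, hra⟩ := exists_box_scaling a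
  obtain ⟨k, hk, hsum⟩ := exists_eq_sum_single (r⁻¹ • a)
  have h1 := h k hk (fun j => (r⁻¹ • a) j) fun j => hra j
  rw [← hsum, map_smul_eq_mul, map_smul_eq_mul] at h1
  exact le_of_mul_le_mul_left h1 (norm_pos_iff.2 (inv_ne_zero hr.ne'))

/-- Two spreading models of order `ξ` are dominated by one lying between their maximum and their
sum. -/
theorem exists_join (hξ : 1 ≤ ξ) {P : Bool → Seminorm ℝ (ℕ →₀ ℝ)}
    (hP : ∀ b, P b ∈ spreadingModelSet X ξ) :
    ∃ p ∈ spreadingModelSet X ξ, (∀ b a, P b a ≤ p a) ∧ ∀ a, p a ≤ P false a + P true a := by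
  have D : ∀ b, Presentation X ξ (P b) := fun b => (exists_presentation (hP b)).some
  obtain ⟨m, hm, hmL, hmsel, hmv⟩ := exists_interlacing D hξ
  have hR : ∀ b, IsRegularFamily (D b).R := fun b => (D b).regular
  set S := (D false).R ∪ (D true).R with hS
  have hSreg : IsRegularFamily S := (hR false).union (hR true)
  have hSord : HasOrder S ξ := HasOrder.union (hR false) (hR true) (D false).order (D true).order
  have hRS : ∀ b, (D b).R ⊆ S := by
    intro b
    cases b
    · exact Set.subset_union_left
    · exact Set.subset_union_right
  have h0 : ∀ b, ∅ ∈ (D b).R := fun b => (D b).empty_mem_R hξ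
  set F := {s | Maximal (· ∈ S) s} with hF
  set L := oddRange m with hL
  have hLinf : L.Infinite :=
    Set.infinite_range_of_injective (hm.comp bit_true_strictMono).injective
  set Ψ : Bool → Finset ℕ → Finset ℕ := fun b => shiftTrunc m b (D b).R with hΨ
  set z : Finset ℕ → X := fun s => ∑ b, (D b).vec (Ψ b s) with hz
  have hΨidx : ∀ b (s : Finset ℕ), (s : Set ℕ) ⊆ L → ∀ n ∈ Ψ b s, ∃ i,
      m (Nat.bit true i) ∈ s ∧ n = m (Nat.bit b i) := by
    intro b s hs n hn
    obtain ⟨n', hn', rfl⟩ := Finset.mem_image.1 (trunc_subset _ _ hn)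
    obtain ⟨i, rfl⟩ := hs hn'
    exact ⟨i, hn', shift_apply hm b i⟩
  have hΨL : ∀ b (s : Finset ℕ), (s : Set ℕ) ⊆ L → (Ψ b s : Set ℕ) ⊆ (D b).L := by
    intro b s hs n hn
    obtain ⟨i, -, rfl⟩ := hΨidx b s hs n hn
    have h := hmL (Nat.bit b i)
    rwa [Nat.bodd_bit] at h
  have hΨQ : ∀ b (s : Finset ℕ), (s : Set ℕ) ⊆ L → Ψ b s ∈ (D b).Q := fun b s hs =>
    ⟨trunc_mem (hR b) (h0 b) _, hΨL b s hs⟩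
  have hΨF : ∀ b, ∀ s ∈ restrictFamily F L, Ψ b s ∈ (D b).F := by
    intro b s hs
    refine shiftTrunc_mem_maximal hm (hR b) (h0 b) (hRS b) ?_ hs.1 hs.2
    rintro i rfl t ht htm htR htF
    refine (hmsel i t ht ⟨htR, fun a ha => ?_⟩ htF).1
    obtain ⟨i', hi', rfl⟩ := htm a ha
    exact hi' ▸ hmL i'
  choose! v hv hvP using hmv
  have hest : ∀ k, 0 < k → ∀ l, k ≤ l + 1 → ∀ s : Fin k → Finset ℕ, Plegma s →
      (∀ j, s j ∈ restrictFamily F L) → (∀ j, ∀ n ∈ s j, m (Nat.bit true l) ≤ n) →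
      ∀ a : Fin k → ℝ, (∀ j, |a j| ≤ 1) → |‖∑ j, a j • z (s j)‖ - v k a| ≤ 2 * (1 / 2) ^ l := by
    intro k hk l hkl s hs hsF hsl a ha
    have := hv k hk l hkl
      (fun q => shiftTrunc m (kind q) (D (kind q)).R (s (ofLex q).1))
      (hs.shiftTrunc hm (R := fun b => (D b).R) hR fun j => (hsF j).2)
      (fun q => hΨQ _ _ (hsF _).2) (fun q => hΨF _ _ (hsF _)) ?_ a ha
    · have e : ∑ j, a j • z (s j) = ∑ b, ∑ j, a j • (D b).vec (Ψ b (s j)) := by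
        rw [Finset.sum_comm]
        simp only [hz, Finset.smul_sum]
      rw [e]
      exact this
    · intro q n hn
      obtain ⟨i, hi, rfl⟩ := hΨidx _ _ (hsF _).2 n hn
      refine ⟨Nat.bit (kind q) i, ?_, Nat.bodd_bit _ _, rfl⟩
      have h1 : l ≤ i := bit_true_strictMono.le_iff_le.1 (hm.le_iff_le.1 (hsl _ _ hi))
      rw [Nat.bit_val]
      omega
  have hex : ∀ l, ∃ t : Fin (l + 1) → Finset ℕ, Plegma t ∧ (∀ i, t i ∈ restrictFamily F L) ∧
      ∀ i, ∀ a ∈ t i, m (Nat.bit true l) ≤ a := fun l =>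
    exists_plegma hSreg hSord (Or.inl (h0 false)) hLinf _
  choose w hw hwF hwl using hex
  -- Realizing the values as limits of norms of linear images makes them a seminorm. The default 0
  -- does not affect the limit at a fixed vector, whose support eventually lies below `l + 1`.
  set T : ℕ → (ℕ →₀ ℝ) →ₗ[ℝ] X := fun l => Finsupp.linearCombination ℝ fun i =>
    if hi : i < l + 1 then z (w l ⟨i, hi⟩) else 0 with hT
  have hTest : ∀ k, 0 < k → ∀ l, k ≤ l + 1 → ∀ a : Fin k → ℝ, (∀ j, |a j| ≤ 1) →
      |‖T l (∑ j : Fin k, Finsupp.single (j : ℕ) (a j))‖ - v k a| ≤ 2 * (1 / 2) ^ l := by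
    intro k hk l hkl a ha
    have := hest k hk l hkl (fun j => w l (Fin.castLE hkl j))
      ((hw l).comp (Fin.strictMono_castLE hkl)) (fun j => hwF l _) (fun j => hwl l _) a ha
    have e : T l (∑ j : Fin k, Finsupp.single (j : ℕ) (a j)) =
        ∑ j, a j • z (w l (Fin.castLE hkl j)) := by
      rw [map_sum]
      refine Finset.sum_congr rfl fun j _ => ?_
      rw [hT, Finsupp.linearCombination_single, dif_pos (j.2.trans_le hkl)]
      rfl
    rwa [e]
  have hpow : Tendsto (fun l : ℕ => (2 : ℝ) * (1 / 2) ^ l) atTop (𝓝 0) := by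
    simpa using (tendsto_pow_atTop_nhds_zero_of_lt_one (r := (1 / 2 : ℝ)) (by norm_num)
      (by norm_num)).const_mul 2
  have hlim : ∀ k, 0 < k → ∀ a : Fin k → ℝ, (∀ j, |a j| ≤ 1) →
      Tendsto (fun l => ‖T l (∑ j : Fin k, Finsupp.single (j : ℕ) (a j))‖) atTop (𝓝 (v k a)) := by
    intro k hk a ha
    refine tendsto_iff_dist_tendsto_zero.2 (squeeze_zero' (Eventually.of_forall fun _ =>
      dist_nonneg) ?_ hpow)
    filter_upwards [eventually_ge_atTop k] with l hl
    exact hTest k hk l (by omega) a ha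
  obtain ⟨p, hp⟩ := exists_seminorm_of_tendsto hlim
  have hpv : ∀ k, 0 < k → ∀ a : Fin k → ℝ, (∀ j, |a j| ≤ 1) →
      p (∑ j : Fin k, Finsupp.single (j : ℕ) (a j)) = v k a := fun k hk a ha =>
    tendsto_nhds_unique (hp _) (hlim k hk a ha)
  refine ⟨p, ⟨F, L, z, ⟨S, hSreg, hSord, rfl⟩, hLinf, ?_, ?_, ?_⟩, fun b => ?_, ?_⟩
  · refine ⟨fun c => ∑ b, (D b).φ (charFun (Ψ b (Function.invFun charFun c))), ?_, fun s _ => ?_⟩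
    · rw [hF, familyHat_maximal hSreg (wellFounded_properExt hSord.choose)]
      simp only [map_sum]
      refine continuousOn_finsetSum _ fun b _ => ?_
      refine (D b).continuousOn.comp (continuousOn_shiftTrunc hm b (D b).R S) ?_
      rintro _ ⟨s, hs, rfl⟩
      simp only [Function.leftInverse_invFun charFun_injective s]
      exact Set.mem_image_of_mem _ (hΨQ b s hs.2)
    · simp only [Function.leftInverse_invFun charFun_injective s]
      rfl
  · intro f ε hε
    choose N hN using fun b => (D b).weaklyNull f (ε / 2) (half_pos hε)
    refine ⟨m (Nat.bit true (max (N false) (N true))), fun s hs hsn => ?_⟩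
    have hb : ∀ b, |f ((D b).vec (Ψ b s))| < ε / 2 := by
      intro b
      refine hN b _ ⟨hΨF b s hs, hΨL b s hs.2⟩ fun n hn => ?_
      obtain ⟨i, hi, rfl⟩ := hΨidx b s hs.2 n hn
      have h1 := bit_true_strictMono.le_iff_le.1 (hm.le_iff_le.1 (hsn _ hi))
      have h2 : N b ≤ max (N false) (N true) := by
        cases b
        · exact le_max_left _ _
        · exact le_max_right _ _
      have h3 : Nat.bit b i ≤ m (Nat.bit b i) := hm.id_le _
      have h4 : i ≤ Nat.bit b i := by
        rw [Nat.bit_val]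
        omega
      omega
    simp only [hz, Fintype.sum_bool, map_add]
    exact (abs_add_le _ _).trans_lt (by linarith [hb true, hb false])
  · refine ⟨fun l => 2 * (1 / 2) ^ l, fun l => by positivity, hpow, ?_⟩
    intro l k hk hkl a ha s hs hpl hmin
    have ha' : ∀ j, |a j| ≤ 1 := fun j => abs_le.2 (ha j)
    rw [hpv k hk a ha']
    refine hest k hk l hkl s hpl.plegma hs (fun j n hn => ?_) a ha'
    rw [infElt_oddRange hm] at hmin
    have hmem := finElt_mem (Finset.card_pos.2 (hpl.nonempty ⟨0, hk⟩))
    -- Only the first set has its minimum bounded below; the plegma order passes the bound to the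
    -- others.
    refine hmin.trans (le_trans ?_ (finElt_zero_le hn))
    have h2 := finElt_mem (Finset.card_pos.2 (hpl.nonempty j))
    rcases eq_or_lt_of_le (Nat.zero_le (j : ℕ)) with hj | hj
    · have : j = ⟨0, hk⟩ := Fin.ext hj.symm
      rw [this]
    · exact (hpl.lt_of_lt ⟨0, hk⟩ j hj 0 (Finset.card_pos.2 (hpl.nonempty _))
        (Finset.card_pos.2 (hpl.nonempty _))).le
  · refine seminorm_le_of_box fun k hk a ha => ?_
    rw [hpv k hk a ha]
    exact (hvP k hk a ha).1 b
  · refine fun a => seminorm_le_of_box (q := P false + P true) (fun k hk a ha => ?_) a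
    rw [hpv k hk a ha]
    have := (hvP k hk a ha).2
    rw [Fintype.sum_bool, add_comm] at this
    exact this

theorem exists_finite_join (hξ : 1 ≤ ξ) (k : ℕ) (e : Fin (k + 1) → SM X ξ) :
    ∃ f : SM X ξ, ∀ a : ℕ →₀ ℝ,
      (∀ i, (e i).norm a ≤ f.norm a) ∧ f.norm a ≤ ∑ i, (e i).norm a := by
  induction k with
  | zero =>
    refine ⟨e 0, fun a => ⟨fun i => ?_, ?_⟩⟩
    · rw [Fin.fin_one_eq_zero i]
    · simp
  | succ k ih =>
    obtain ⟨g, hg⟩ := ih fun i => e i.castSucc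
    obtain ⟨p, hp, h1, h2⟩ := exists_join hξ (X := X)
      (P := fun b => bif b then (e (Fin.last _)).norm else g.norm)
      (fun b => by cases b; exacts [g.mem, (e _).mem])
    refine ⟨⟨p, hp⟩, fun a => ⟨fun i => ?_, ?_⟩⟩
    · induction i using Fin.lastCases with
      | last => exact h1 true a
      | cast i => exact ((hg a).1 i).trans (h1 false a)
    · rw [Fin.sum_univ_castSucc]
      exact (h2 a).trans (add_le_add_left (hg a).2 _)

end Join

/-! ### The semi-lattice structure -/

theorem theorem18 {X : Type*} [NormedAddCommGroup X] [NormedSpace ℝ X] [CompleteSpace X]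
    (ξ : Ordinal.{0}) (hξ_pos : 1 ≤ ξ) (hξ_countable : ξ < ω₁) :
    (∀ u v : SMQuotient X ξ, ∃ w : SMQuotient X ξ, IsLUB {u, v} w) ∧
    (∀ (k : ℕ), 1 ≤ k → ∀ e : Fin k → SM X ξ, ∃ f : SM X ξ, ∀ a : ℕ →₀ ℝ,
      (∀ i, (e i).norm a ≤ f.norm a) ∧ f.norm a ≤ ∑ i, (e i).norm a) := by
  refine ⟨fun u v => ?_, fun k hk e => ?_⟩
  · induction u using Quotient.inductionOn with | _ e
    induction v using Quotient.inductionOn with | _ e'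
    obtain ⟨f, hf⟩ := exists_finite_join hξ_pos 1 ![e, e']
    refine ⟨toAntisymmetrization (· ≤ ·) f, ?_, ?_⟩
    · rintro w (rfl | rfl)
      · exact toAntisymmetrization_le_toAntisymmetrization_iff.2
          ⟨1, one_pos, fun a => by simpa using (hf a).1 0⟩
      · exact toAntisymmetrization_le_toAntisymmetrization_iff.2
          ⟨1, one_pos, fun a => by simpa using (hf a).1 1⟩
    · intro w hw
      induction w using Quotient.inductionOn with | _ g
      obtain ⟨C, hC, h1⟩ := toAntisymmetrization_le_toAntisymmetrization_iff.1
        (hw (Set.mem_insert _ _))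
      obtain ⟨C', hC', h2⟩ := toAntisymmetrization_le_toAntisymmetrization_iff.1
        (hw (Set.mem_insert_of_mem _ rfl))
      -- The upper estimate by the sum makes `f` least: constants `C` and `C'` for the two elements
      -- add up.
      refine toAntisymmetrization_le_toAntisymmetrization_iff.2
        ⟨C + C', add_pos hC hC', fun a => (hf a).2.trans ?_⟩
      rw [Fin.sum_univ_two, add_mul]
      exact add_le_add (h1 a) (h2 a)
  · obtain ⟨k, rfl⟩ := Nat.exists_eq_add_of_le' hk
    exact exists_finite_join hξ_pos k e
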